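/- Let $I=[0,1]$ and let $\mathrm{Homeo}_+(I)$ be the group of orientation-preserving homeomorphisms of $I$. The support of $f\in\mathrm{Homeo}_+(I)$ is $\{t\in I: f(t)\ne t\}$; its connected components are the orbitals of $f$, the endpoints of the orbitals are the transition points of $f$, and the extended support of $f$ is the interior (in $\mathbb{R}$) of the closure of the support. The restriction of $f$ to an orbital (extended by the identity) is called a bump of $f$; it is positive if $f(t)>t$ on the orbital and negative if $f(t)<t$ there. A marked function is an $f\in\mathrm{Homeo}_+(I)$ together with a choice of a point (marker) $s$ in each orbital $(u,v)$; the feet of the corresponding bump are the intervals $(u,s)$ (left foot) and $[t,v)$ (right foot), where $t=f(s)$ if the bump is positive and $t=f^{-1}(s)$ if it is negative. A finite set of marked functions with finitely many bumps each is fast if distinct bumps occurring in it have disjoint feet and no bump occurs in two of its elements. A standard function is a nontrivial marked function with finitely many bumps such that (i) its extended support is an interval; (ii) every positive bump is to the right of every negative bump; (iii) the number of positive bumps is equal to, or exceeds by exactly one, the number of negative bumps. For standard functions write $f\ll g$ if the extended supports of $f$ and $g$ are disjoint and that of $f$ lies to the left of that of $g$; write $f\sqsubset g$ if the closure of the extended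 support of $f$ is contained in the extended support of $g$; and write $f<g$ if $f\ll g$ or $f\sqsubset g$. If a standard function $f$ has more than two orbitals, let $f^\circ$ be the marked function that agrees with $f$, with the same markers, on all orbitals of $f$ except the leftmost and the rightmost, and is the identity elsewhere; if $f$ has one or two orbitals, let $f^\circ$ be any positive bump, with any marker, whose support is the left foot of the positive orbital of $f$. A pair $(f,g)$ of standard functions is, recursively, a standard pair if $\{f,g\}$ is fast and either $f\ll g$, or else $f\sqsubset g$ and $(g^\circ,f)$ is a standard pair. A standard generating set is a finite set $A$ of standard functions such that for any two distinct elements $f,g\in A$, one of $(f,g)$, $(g,f)$ is a standard pair; such a set is totally ordered by $<$. For $f<g$ in $A$, the oscillation $o(f,g)$ is the number of orbitals of $g$ that contain at least one transition point of $f$. Two standard generating sets $A,B$ have the same signature if $|A|=|B|$ and the order-preserving bijection $\theta:A\to B$ satisfies $o(f,g)=o(\theta(f),\theta(g))$ for all $f<g$ in $A$. Let $\langle A\rangle$ denote the subgroup of $\mathrm{Homeo}_+(I)$ generated by $A$. Theorem. If two standard generating sets $A$ and $B$ have the same signature, then the (unique) order-preserving bijection $A\to B$ extends to a group isomorphism $\langle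 A\rangle\to\langle B\rangle$. -/

import Mathlib

namespace StdGen

/-- The group of orientation-preserving homeomorphisms of `I = [0,1]`. An orientation-preserving
homeomorphism of `[0,1]` is the same thing as an order automorphism of `[0,1]` (continuity of an
order automorphism and of its inverse is automatic). -/
abbrev HomeoPlus : Type := unitInterval ≃o unitInterval

/-- The support of `f`: the set of points moved by `f`. -/
def supp (f : HomeoPlus) : Set unitInterval := {t | f t ≠ t}

/-- The extended support of `f`: the interior of the closure of the support. Interior and closure
are taken in the real line, so that the extended support lies in the open interval `(0,1)` even if
the support is dense in `[0,1]`. -/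
def extSupp (f : HomeoPlus) : Set ℝ :=
  interior (closure ((fun t : unitInterval => (t : ℝ)) '' supp f))

/-- The orbitals of `f`, that is the connected components of its support. The component `(u, v)`
is recorded by its pair of endpoints: `u < v` are fixed by `f` and no point strictly between
them is. (The points `0` and `1` are always fixed, so every component has this form.) -/
def orbitals (f : HomeoPlus) : Set (unitInterval × unitInterval) :=
  {p | p.1 < p.2 ∧ f p.1 = p.1 ∧ f p.2 = p.2 ∧ ∀ t ∈ Set.Ioo p.1 p.2, f t ≠ t}

/-- The transition points of `f`: the endpoints of its orbitals. -/
def transitionPoints (f : HomeoPlus) : Set unitInterval :=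
  {x | ∃ p ∈ orbitals f, x = p.1 ∨ x = p.2}

/-- The orbitals of `f` that carry a positive bump of `f`. -/
def posOrbitals (f : HomeoPlus) : Set (unitInterval × unitInterval) :=
  {p | p ∈ orbitals f ∧ ∀ t ∈ Set.Ioo p.1 p.2, t < f t}

/-- The orbitals of `f` that carry a negative bump of `f`. -/
def negOrbitals (f : HomeoPlus) : Set (unitInterval × unitInterval) :=
  {p | p ∈ orbitals f ∧ ∀ t ∈ Set.Ioo p.1 p.2, f t < t}

/-- A marked function: an orientation-preserving homeomorphism of `[0,1]` with a choice of one
point in each of its orbitals. -/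
structure MarkedFun where
  /-- the underlying homeomorphism -/
  toHomeo : HomeoPlus
  /-- the marker of each bump -/
  marker : orbitals toHomeo → unitInterval
  marker_mem : ∀ p : orbitals toHomeo, marker p ∈ Set.Ioo p.1.1 p.1.2

/-- The left foot `(u, s)` of the bump of `f` with orbital `(u, v)` and marker `s`. -/
def leftFoot (f : MarkedFun) (p : orbitals f.toHomeo) : Set unitInterval :=
  Set.Ioo p.1.1 (f.marker p)

open Classical in
/-- The right foot `[t, v)` of the bump of `f` with orbital `(u, v)` and marker `s`, where `t` is
the image of `s` under `f` if the bump is positive, and under the inverse of `f` otherwise. -/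
noncomputable def rightFoot (f : MarkedFun) (p : orbitals f.toHomeo) : Set unitInterval :=
  Set.Ico (if p.1 ∈ posOrbitals f.toHomeo then f.toHomeo (f.marker p)
    else f.toHomeo.symm (f.marker p)) p.1.2

/-- The union of the two feet of a bump. -/
noncomputable def feet (f : MarkedFun) (p : orbitals f.toHomeo) : Set unitInterval :=
  leftFoot f p ∪ rightFoot f p

/-- A finite set of marked functions with finitely many bumps each is (geometrically) fast if no
bump occurs in two of its elements and distinct bumps have disjoint feet. Bumps are indexed here
by the function and the orbital on which they occur; as feet are nonempty, a bump that occurred in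
two different elements would violate the disjointness. -/
def IsFast (S : Set MarkedFun) : Prop :=
  S.Finite ∧ (∀ f ∈ S, (orbitals f.toHomeo).Finite) ∧
    ∀ f ∈ S, ∀ g ∈ S, ∀ (p : orbitals f.toHomeo) (q : orbitals g.toHomeo),
      (f ≠ g ∨ p.1 ≠ q.1) → Disjoint (feet f p) (feet g q)

/-- Standard functions: nontrivial, with finitely many bumps, the extended support is an interval,
every positive bump is to the right of every negative bump, and the number of positive bumps
equals the number of negative bumps or exceeds it by one. -/
structure IsStandard (f : MarkedFun) : Prop where
  finite : (orbitals f.toHomeo).Finite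
  nonempty : (orbitals f.toHomeo).Nonempty
  interval : (extSupp f.toHomeo).OrdConnected
  neg_left_pos : ∀ p ∈ negOrbitals f.toHomeo, ∀ q ∈ posOrbitals f.toHomeo, p.2 ≤ q.1
  neg_le_pos : (negOrbitals f.toHomeo).ncard ≤ (posOrbitals f.toHomeo).ncard
  pos_le_neg : (posOrbitals f.toHomeo).ncard ≤ (negOrbitals f.toHomeo).ncard + 1

/-- `f ≪ g`: the extended supports are disjoint and that of `f` is to the left of that of `g`. -/
def FarLeft (f g : MarkedFun) : Prop :=
  ∀ x ∈ extSupp f.toHomeo, ∀ y ∈ extSupp g.toHomeo, x < y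

/-- `f ⊏ g`: the closure of the extended support of `f` is contained in the extended support
of `g`. -/
def Nested (f g : MarkedFun) : Prop :=
  closure (extSupp f.toHomeo) ⊆ extSupp g.toHomeo

/-- `f < g`: `f ≪ g` or `f ⊏ g`. -/
def Precedes (f g : MarkedFun) : Prop := FarLeft f g ∨ Nested f g

/-- The union of all orbitals of `f` except the leftmost one and the rightmost one. -/
def innerSupp (f : HomeoPlus) : Set unitInterval :=
  {t | ∃ p ∈ orbitals f, (∃ q ∈ orbitals f, q.1 < p.1) ∧ (∃ q ∈ orbitals f, p.1 < q.1) ∧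
    t ∈ Set.Ioo p.1 p.2}

/-- `IsReduct f f'`: the marked function `f'` is a legitimate choice of `f°`. If `f` has more than
two orbitals, `f'` agrees with `f` on the orbitals of `f` other than the leftmost and the rightmost
one, is the identity elsewhere, and has the markers of `f` on the remaining orbitals. If `f` has at
most two orbitals, `f'` is any positive bump, arbitrarily marked, whose support is the left foot
of the positive orbital of `f`. -/
def IsReduct (f f' : MarkedFun) : Prop :=
  (2 < (orbitals f.toHomeo).ncard ∧
    (∀ t ∈ innerSupp f.toHomeo, f'.toHomeo t = f.toHomeo t) ∧
    (∀ t ∉ innerSupp f.toHomeo, f'.toHomeo t = t) ∧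
    ∀ (p : unitInterval × unitInterval) (h : p ∈ orbitals f.toHomeo)
      (h' : p ∈ orbitals f'.toHomeo), f'.marker ⟨p, h'⟩ = f.marker ⟨p, h⟩) ∨
  ((orbitals f.toHomeo).ncard ≤ 2 ∧
    ∃ p : orbitals f.toHomeo, p.1 ∈ posOrbitals f.toHomeo ∧
      orbitals f'.toHomeo = {(p.1.1, f.marker p)} ∧
      posOrbitals f'.toHomeo = {(p.1.1, f.marker p)})

/-- Standard pairs of standard functions: `{f, g}` is fast and either `f ≪ g`, or else `f ⊏ g` and
`(g°, f)` is a standard pair. -/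
inductive IsStandardPair : MarkedFun → MarkedFun → Prop
  | farLeft {f g : MarkedFun} (hf : IsStandard f) (hg : IsStandard g) (hfast : IsFast {f, g})
      (h : FarLeft f g) : IsStandardPair f g
  | nested {f g g' : MarkedFun} (hf : IsStandard f) (hg : IsStandard g) (hfast : IsFast {f, g})
      (h : Nested f g) (hg' : IsReduct g g') (hrec : IsStandardPair g' f) : IsStandardPair f g

/-- Standard generating sets: finite sets of standard functions, any two distinct elements of which
form, in one of the two orders, a standard pair. -/
structure IsStandardGenSet (A : Set MarkedFun) : Prop where
  finite : A.Finite
  standard : ∀ f ∈ A, IsStandard f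
  pairwise : A.Pairwise fun f g => IsStandardPair f g ∨ IsStandardPair g f

/-- The oscillation `o(f, g)` of `f < g`: the number of orbitals of `g` that contain at least one
transition point of `f`. -/
noncomputable def osc (f g : MarkedFun) : ℕ :=
  {p | p ∈ orbitals g.toHomeo ∧
    ∃ x ∈ transitionPoints f.toHomeo, x ∈ Set.Ioo p.1 p.2}.ncard

/-- A bijection between two sets of marked functions preserves the order `<`. -/
def OrderPreserving {A B : Set MarkedFun} (θ : A ≃ B) : Prop :=
  ∀ f g : A, Precedes f.1 g.1 ↔ Precedes (θ f).1 (θ g).1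

/-- `A` and `B` have the same signature: there is an order-preserving bijection from `A` to `B`
that preserves the oscillation of all pairs `f < g`. -/
def SameSignature (A B : Set MarkedFun) : Prop :=
  ∃ θ : A ≃ B, OrderPreserving θ ∧
    ∀ f g : A, Precedes f.1 g.1 → osc f.1 g.1 = osc (θ f).1 (θ g).1

/-- The group of homeomorphisms generated by a set of marked functions. -/
def gen (A : Set MarkedFun) : Subgroup HomeoPlus :=
  Subgroup.closure (MarkedFun.toHomeo '' A)

/-- An element of `A`, regarded as an element of the group generated by `A`. -/
def toGen {A : Set MarkedFun} (f : A) : gen A :=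
  ⟨f.1.toHomeo, Subgroup.subset_closure ⟨f.1, f.2, rfl⟩⟩

end StdGen

/-!
The free group on `A` acts on the interval through `A` and, by the given bijection, through `B`. It
suffices to show that the two actions have the same kernel (`PingPong.wordAct_eq_one`).

*Geometry.* The orbitals of a standard function, numbered from the outside to the inside, are
alternately the rightmost and the leftmost of those that remain, so that its transition points form
a spiral `z 0 > z 2 > ⋯`, `z 1 < z 3 < ⋯` (`IsSpiral`). Passing from `g` to `g°` shifts the spiral
of `g` by two places. By induction on the definition of a standard pair `(f, g)`, the spirals
`z` of `f` and `y` of `g` interleave (`IsStandardPair.loc`): with `N` the oscillation of the pair,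
`z k` lies in the orbital number `min (k + 1) N` of `g`, and `y k` in the orbital number
`min (k - 1) (N - 1)` of `f`, where the number `0` means that there is no such orbital. By fastness
the foot attached to a transition point lies in the same orbitals of the other functions as the
point itself. So the order and the oscillation numbers determine which feet lie in which orbitals
(`footLoc`), for as many orbitals as there are.

*Dynamics.* Each function is made to play ping-pong with half-open feet (`PingPong`). A point in a
foot is pulled back out of it, and so on; this gives its history, a list of feet (`Hist`). Words act
on sufficiently long histories by a rule that depends on `footLoc` only (`push`). The action of a
word on the interval is trivial if and only if its action on long histories is:

* A nontrivial word `w` has a component of its support, with left endpoint `c`, say. If `c` has a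
  finite history, so that it comes from a point outside all feet, then the points just to the right
  of `c` have the same history as `c` and start in the same orbitals. Since `w` fixes `c`, it then
  fixes them as well, which is absurd. So `c` has a long history, which has to be moved by `w` for
  the same reason (`exists_deep_hist`).
* A trivial word fixes the two points that are reached by the same history from the marker of a bump
  and from the first point of one of its half-open feet. No foot contains both of the starting
  points, so the history is determined by these two points, and the word fixes it
  (`pushWord_eq_of_wordAct_eq_one`).

*Comparison.* The two sets may differ in the numbers of orbitals, which are not part of the
signature. An orbital that is present in only one of them contains no transition points of other
functions, so that its feet can occur in a history only at its start, as a constant list. To all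
other functions they look like the inner foot of the innermost bump that is present in the other
set (`PingPong.sat`), and a constant list of this foot serves as a replacement
(`pushWord_append_replicate`).
-/

open Set Filter Topology

namespace StdGen

/-! ### Words and histories in a ping-pong system -/

variable {ι : Type*}

/-- A label for a foot: the index `idx` of the function, the number `num ≥ 1` of its orbital, and
`out`, which is `true` if the function itself pushes into the foot, and `false` if its inverse
does. -/
structure Foot (ι : Type*) where
  idx : ι
  num : ℕ
  out : Bool

/-- The other foot of the same bump. -/
def Foot.opp (φ : Foot ι) : Foot ι := ⟨φ.idx, φ.num, !φ.out⟩

/-- The homeomorphism that a letter `(j, true)` or `(j, false)` stands for: `f j` or its inverse. -/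
def letterAct (f : ι → HomeoPlus) (a : ι × Bool) : HomeoPlus := bif a.2 then f a.1 else (f a.1)⁻¹

/-- The homeomorphism that pushes into a foot. -/
def Foot.act (f : ι → HomeoPlus) (φ : Foot ι) : HomeoPlus := letterAct f (φ.idx, φ.out)

/-- The homeomorphism that a word stands for. -/
def wordAct (f : ι → HomeoPlus) (L : List (ι × Bool)) : HomeoPlus := (L.map (letterAct f)).prod

open Classical in
/-- The effect of a letter on a history. The number `D j φ` is that of the orbital of the `j`-th
function that contains the foot `φ`, or `0` if there is none; `β j` is the same for the point at
which the history starts. -/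
noncomputable def push (D : ι → Foot ι → ℕ) (β : ι → ℕ) (a : ι × Bool) :
    List (Foot ι) → List (Foot ι)
  | [] => if β a.1 = 0 then [] else [⟨a.1, β a.1, a.2⟩]
  | φ :: h => if D a.1 φ = 0 then φ :: h else
      if φ.idx = a.1 ∧ φ.out = !a.2 then h else ⟨a.1, D a.1 φ, a.2⟩ :: φ :: h

/-- The effect of a word on a history. -/
noncomputable def pushWord (D : ι → Foot ι → ℕ) (β : ι → ℕ) (L : List (ι × Bool))
    (h : List (Foot ι)) : List (Foot ι) := L.foldr (push D β) h

/-- A ping-pong system for the functions `f`: for each function finitely many half-open orbitals,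
numbered from `1` on, and in each of them two half-open feet. How the feet of different functions
lie relative to each other is recorded by `D`: the foot `φ` lies in the orbital number `D j φ` of
`f j`, and outside the support of `f j` if `D j φ = 0`. Orbitals and feet with a number out of
range are empty.

By `sep`, each bump has two starting points for a push into a given foot that no foot contains
both. By `sat`, to the other functions the feet with a number out of range look like the inner foot
of the innermost bump. -/
structure PingPong (f : ι → HomeoPlus) (D : ι → Foot ι → ℕ) where
  n : ι → ℕ
  n_pos : ∀ i, 1 ≤ n i
  orb : ι → ℕ → Set unitInterval
  foot : Foot ι → Set unitInterval
  D_self : ∀ φ : Foot ι, D φ.idx φ = φ.num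
  orb_valid : ∀ {i k x}, x ∈ orb i k → 1 ≤ k ∧ k ≤ n i
  foot_sub : ∀ {φ x}, x ∈ foot φ → x ∈ orb φ.idx φ.num
  push_mem : ∀ {φ x}, x ∈ orb φ.idx φ.num → x ∉ foot φ.opp → φ.act f x ∈ foot φ
  pull_mem : ∀ {φ x}, x ∈ foot φ →
    (φ.act f)⁻¹ x ∈ orb φ.idx φ.num ∧ (φ.act f)⁻¹ x ∉ foot φ.opp
  fix : ∀ {i x}, (∀ k, x ∉ orb i k) → f i x = x
  orb_disj : ∀ {i k k' x}, x ∈ orb i k → x ∈ orb i k' → k = k'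
  loc_zero : ∀ {φ x j}, x ∈ foot φ → D j φ = 0 → ∀ k, x ∉ orb j k
  loc_pos : ∀ {φ x j}, x ∈ foot φ → D j φ ≠ 0 → x ∈ orb j (D j φ)
  foot_disj : ∀ {φ ψ x}, x ∈ foot φ → x ∈ foot ψ → φ = ψ
  orb_right : ∀ i k x, ∀ᶠ y in 𝓝[>] x, y ∈ orb i k ↔ x ∈ orb i k
  foot_right : ∀ φ x, ∀ᶠ y in 𝓝[>] x, y ∈ foot φ ↔ x ∈ foot φ
  sep : ∀ φ : Foot ι, 1 ≤ φ.num → φ.num ≤ n φ.idx →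
    ∃ y₀ y₁, y₀ ∈ orb φ.idx φ.num ∧ y₀ ∉ foot φ.opp ∧ y₁ ∈ orb φ.idx φ.num ∧ y₁ ∉ foot φ.opp ∧
      ∀ ψ, y₀ ∈ foot ψ → y₁ ∉ foot ψ
  D_le : ∀ {φ : Foot ι} {j}, 1 ≤ φ.num → φ.num ≤ n φ.idx → D j φ ≤ n j
  sat : ∀ {i j k e}, j ≠ i → n i < k → D j ⟨i, k, e⟩ = D j ⟨i, n i, false⟩

namespace PingPong

variable {f : ι → HomeoPlus} {D : ι → Foot ι → ℕ} (P : PingPong f D)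

/-- `P.Hist x h x₀`: the point `x` is reached from `x₀` by pushing successively into the feet of
the list `h` (the head of the list being the last one), never undoing a push. -/
inductive Hist : unitInterval → List (Foot ι) → unitInterval → Prop
  | nil (x) : Hist x [] x
  | cons {x h x₀} (φ : Foot ι) (hx : Hist x h x₀) (ho : x ∈ P.orb φ.idx φ.num)
      (hf : x ∉ P.foot φ.opp) : Hist (φ.act f x) (φ :: h) x₀

/-- `x₀` lies in no foot, and `β j` is the number of the orbital of `f j` that contains it, or `0`
if there is none. -/
def IsBase (β : ι → ℕ) (x₀ : unitInterval) : Prop :=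
  (∀ φ, x₀ ∉ P.foot φ) ∧ ∀ j, (β j = 0 → ∀ k, x₀ ∉ P.orb j k) ∧ (β j ≠ 0 → x₀ ∈ P.orb j (β j))

variable {P}

lemma letterAct_of_fix {a : ι × Bool} {x : unitInterval} (h : f a.1 x = x) :
    letterAct f a x = x := by
  obtain ⟨j, b⟩ := a
  cases b
  · change (f j)⁻¹ x = x
    conv_lhs => rw [← h]
    exact RelIso.inv_apply_self _ _
  · exact h

lemma letterAct_not (i : ι) (b : Bool) (x : unitInterval) :
    letterAct f (i, b) (letterAct f (i, !b) x) = x := by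
  cases b
  · exact RelIso.inv_apply_self _ _
  · exact RelIso.apply_inv_self _ _

lemma Hist.mem_foot {x x₀ : unitInterval} {φ : Foot ι} {h : List (Foot ι)}
    (H : P.Hist x (φ :: h) x₀) : x ∈ P.foot φ := by
  cases H with
  | cons _ _ ho hf => exact P.push_mem ho hf

lemma Hist.eq {x x' x₀ : unitInterval} {h : List (Foot ι)} (H : P.Hist x h x₀)
    (H' : P.Hist x' h x₀) : x = x' := by
  induction H generalizing x' with
  | nil x => cases H'; rfl
  | cons φ _ _ _ ih =>
    cases H' with
    | cons _ h2 _ _ => rw [ih h2]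

/-- A letter acts on points as it does on their histories, as long as the history does not run
out. -/
lemma Hist.letter {x x₀ : unitInterval} {h : List (Foot ι)} {β : ι → ℕ} (H : P.Hist x h x₀)
    (hb : h ≠ [] ∨ P.IsBase β x₀) (a : ι × Bool) :
    P.Hist (letterAct f a x) (push D β a h) x₀ := by
  obtain ⟨j, b⟩ := a
  cases H with
  | nil =>
    have hb := hb.resolve_left (by simp)
    simp only [push]
    split_ifs with h0
    · rw [letterAct_of_fix (P.fix ((hb.2 j).1 h0))]
      exact .nil _
    · exact Hist.cons (P := P) ⟨j, β j, b⟩ (.nil x) ((hb.2 j).2 h0) (hb.1 _)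
  | @cons x h _ φ hx ho hf =>
    have hm := P.push_mem ho hf
    simp only [push]
    split_ifs with h0 h1
    · rw [letterAct_of_fix (P.fix (P.loc_zero hm h0))]
      exact .cons φ hx ho hf
    · obtain ⟨rfl, h1⟩ := h1
      rw [Foot.act, h1, letterAct_not]
      exact hx
    · refine Hist.cons (P := P) ⟨j, D j φ, b⟩ (.cons φ hx ho hf) (P.loc_pos hm h0) fun hm' => h1 ?_
      have := P.foot_disj hm hm'
      exact ⟨congrArg Foot.idx this, congrArg Foot.out this⟩

lemma length_push (β : ι → ℕ) (a : ι × Bool) (h : List (Foot ι)) :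
    h.length ≤ (push D β a h).length + 1 := by
  cases h with
  | nil => simp
  | cons φ h =>
    simp only [push]
    split_ifs <;> simp

lemma length_pushWord (β : ι → ℕ) (L : List (ι × Bool)) (h : List (Foot ι)) :
    h.length ≤ (pushWord D β L h).length + L.length := by
  induction L with
  | nil => simp [pushWord]
  | cons a L ih =>
    have := length_push (D := D) β a (pushWord D β L h)
    simp only [pushWord, List.foldr_cons, List.length_cons] at *
    omega

lemma wordAct_cons (a : ι × Bool) (L : List (ι × Bool)) (x : unitInterval) :
    wordAct f (a :: L) x = letterAct f a (wordAct f L x) := by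
  simp [wordAct, RelIso.mul_apply]

lemma Hist.word {x x₀ : unitInterval} {h : List (Foot ι)} {β : ι → ℕ} (H : P.Hist x h x₀)
    (L : List (ι × Bool)) (hb : L.length ≤ h.length ∨ P.IsBase β x₀) :
    P.Hist (wordAct f L x) (pushWord D β L h) x₀ := by
  induction L with
  | nil => simpa [pushWord, wordAct] using H
  | cons a L ih =>
    rw [wordAct_cons]
    have hb' := hb
    rw [List.length_cons] at hb
    refine (ih (hb.imp_left (by omega))).letter (hb.imp_left fun h1 h2 => ?_) a
    have := length_pushWord (D := D) β L h
    rw [pushWord] at h2 this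
    rw [h2] at this
    simp at this
    omega

/-- Two histories that lead to the same point from each of two starting points agree, provided that
no foot contains both starting points. -/
lemma Hist.unique {x x' y₀ y₁ : unitInterval} {h h' : List (Foot ι)}
    (hy : ∀ ψ, y₀ ∈ P.foot ψ → y₁ ∉ P.foot ψ) (H₀ : P.Hist x h y₀) (H₀' : P.Hist x h' y₀)
    (H₁ : P.Hist x' h y₁) (H₁' : P.Hist x' h' y₁) : h = h' := by
  induction h generalizing h' x x' with
  | nil =>
    cases h' with
    | nil => rfl
    | cons ψ h' =>
      cases H₀; cases H₁
      exact absurd H₁'.mem_foot (hy _ H₀'.mem_foot)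
  | cons φ h ih =>
    cases h' with
    | nil =>
      cases H₀'; cases H₁'
      exact absurd H₁.mem_foot (hy _ H₀.mem_foot)
    | cons ψ h' =>
      obtain rfl := P.foot_disj H₀.mem_foot H₀'.mem_foot
      generalize hz : x = z at H₀'
      generalize hz' : x' = z' at H₁'
      cases H₀ with
      | cons _ a1 _ _ =>
        cases H₁ with
        | cons _ b1 _ _ =>
          cases H₀' with
          | cons _ a2 _ _ =>
            cases H₁' with
            | cons _ b2 _ _ =>
              obtain rfl := (φ.act f).injective hz
              obtain rfl := (φ.act f).injective hz'
              rw [ih a1 a2 b1 b2]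

/-- A point has a history of any given length, or a history that starts at a point outside all
feet. -/
lemma exists_hist (N : ℕ) (x : unitInterval) : (∃ h x₀, P.Hist x h x₀ ∧ h.length = N) ∨
    ∃ h x₀, P.Hist x h x₀ ∧ ∀ φ, x₀ ∉ P.foot φ := by
  induction N generalizing x with
  | zero => exact .inl ⟨[], x, .nil x, rfl⟩
  | succ N ih =>
    by_cases hx : ∃ φ, x ∈ P.foot φ
    · obtain ⟨φ, hφ⟩ := hx
      obtain ⟨h1, h2⟩ := P.pull_mem hφ
      have key : ∀ h x₀, P.Hist ((φ.act f)⁻¹ x) h x₀ → P.Hist x (φ :: h) x₀ := fun h x₀ H => by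
        have := Hist.cons φ H h1 h2
        rwa [RelIso.apply_inv_self] at this
      rcases ih ((φ.act f)⁻¹ x) with ⟨h, x₀, H, hl⟩ | ⟨h, x₀, H, hb⟩
      · exact .inl ⟨φ :: h, x₀, key _ _ H, by simp [hl]⟩
      · exact .inr ⟨φ :: h, x₀, key _ _ H, hb⟩
    · push Not at hx
      exact .inr ⟨[], x, .nil x, hx⟩

lemma tendsto_nhdsGT (g : HomeoPlus) (x : unitInterval) : Tendsto g (𝓝[>] x) (𝓝[>] (g x)) :=
  tendsto_nhdsWithin_of_tendsto_nhds_of_eventually_within _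
    (g.continuous.continuousAt.mono_left nhdsWithin_le_nhds)
    (by filter_upwards [self_mem_nhdsWithin] with y hy using g.strictMono hy)

/-- Histories are locally constant to the right. -/
lemma Hist.eventually {x x₀ : unitInterval} {h : List (Foot ι)} (H : P.Hist x h x₀) :
    ∃ g : HomeoPlus, g x = x₀ ∧ ∀ᶠ y in 𝓝[>] x, P.Hist y h (g y) := by
  induction H with
  | nil x => exact ⟨1, rfl, .of_forall fun y => .nil y⟩
  | @cons x h x₀ φ hx ho hf ih =>
    obtain ⟨g, hg, hev⟩ := ih
    refine ⟨g * (φ.act f)⁻¹, by rw [RelIso.mul_apply, RelIso.inv_apply_self, hg], ?_⟩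
    have ht := tendsto_nhdsGT (φ.act f)⁻¹ (φ.act f x)
    rw [RelIso.inv_apply_self] at ht
    filter_upwards [ht.eventually hev, ht.eventually (P.orb_right φ.idx φ.num x),
      ht.eventually (P.foot_right φ.opp x)] with y h1 h2 h3
    have := Hist.cons φ h1 (h2.2 ho) (fun h4 => hf (h3.1 h4))
    rwa [RelIso.apply_inv_self] at this

lemma exists_isBase {x : unitInterval} (hx : ∀ φ, x ∉ P.foot φ) : ∃ β, P.IsBase β x := by
  classical
  refine ⟨fun j => if h : ∃ k, x ∈ P.orb j k then h.choose else 0, hx, fun j => ?_⟩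
  by_cases h : ∃ k, x ∈ P.orb j k
  · simp only [h, dite_true]
    refine ⟨fun h0 => ?_, fun _ => h.choose_spec⟩
    have := (P.orb_valid h.choose_spec).1
    omega
  · simp only [h, dite_false, ne_eq, not_true_eq_false, false_imp_iff, and_true]
    exact fun _ k hk => h ⟨k, hk⟩

lemma foot_valid {φ : Foot ι} {x : unitInterval} (hx : x ∈ P.foot φ) :
    1 ≤ φ.num ∧ φ.num ≤ P.n φ.idx := P.orb_valid (P.foot_sub hx)

lemma IsBase.eventually [Finite ι] {x : unitInterval} {β : ι → ℕ} (H : P.IsBase β x) :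
    ∀ᶠ y in 𝓝[>] x, P.IsBase β y := by
  have h1 : ∀ᶠ y in 𝓝[>] x, ∀ i, ∀ k ∈ Set.Icc 1 (P.n i), (y ∈ P.orb i k ↔ x ∈ P.orb i k) :=
    eventually_all.2 fun i => (Set.finite_Icc _ _).eventually_all.2 fun k _ => P.orb_right i k x
  have h2 : ∀ᶠ y in 𝓝[>] x, ∀ i, ∀ k ∈ Set.Icc 1 (P.n i), ∀ e : Bool,
      (y ∈ P.foot ⟨i, k, e⟩ ↔ x ∈ P.foot ⟨i, k, e⟩) :=
    eventually_all.2 fun i => (Set.finite_Icc _ _).eventually_all.2 fun k _ =>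
      eventually_all.2 fun e => P.foot_right _ x
  filter_upwards [h1, h2] with y hy1 hy2
  refine ⟨fun φ hφ => H.1 φ ((hy2 φ.idx φ.num (foot_valid hφ) φ.out).1 hφ), fun j =>
    ⟨fun h0 k hk => (H.2 j).1 h0 k ((hy1 j k (P.orb_valid hk)).1 hk), fun h0 => ?_⟩⟩
  have := (H.2 j).2 h0
  exact (hy1 j _ (P.orb_valid this)).2 this

/-- A word that fixes a point, and whose action on the histories of nearby points on the right is
trivial as far as they are long, is trivial to the right of the point. -/
lemma eventually_fix [Finite ι] {L : List (ι × Bool)}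
    (H : ∀ x h x₀, P.Hist x h x₀ → L.length < h.length → pushWord D 0 L h = h)
    {c : unitInterval} (hc : wordAct f L c = c) : ∀ᶠ y in 𝓝[>] c, wordAct f L y = y := by
  rcases P.exists_hist (L.length + 1) c with ⟨h, x₀, hh, hl⟩ | ⟨h, x₀, hh, hb⟩
  · obtain ⟨g, -, hev⟩ := hh.eventually
    filter_upwards [hev] with y hy
    have := hy.word (β := 0) L (.inl (by omega))
    rw [H y h _ hy (by omega)] at this
    exact this.eq hy
  · obtain ⟨β, hβ⟩ := exists_isBase hb
    have h1 := hh.word L (.inr hβ)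
    rw [hc] at h1
    have h2 := Hist.unique (fun ψ h => absurd h (hb ψ)) h1 hh h1 hh
    obtain ⟨g, rfl, hev⟩ := hh.eventually
    filter_upwards [hev, (tendsto_nhdsGT g c).eventually hβ.eventually] with y hy hy'
    have := hy.word L (.inr hy')
    rw [h2] at this
    exact this.eq hy

/-- If a word acts nontrivially, then it acts nontrivially on a history that is longer than the
word. The history is one of the left endpoint of a component of the support. -/
theorem exists_deep_hist [Finite ι] {L : List (ι × Bool)} (hL : wordAct f L ≠ 1) :
    ∃ x h x₀, P.Hist x h x₀ ∧ L.length < h.length ∧ pushWord D 0 L h ≠ h := by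
  by_contra! H
  apply hL
  refine DFunLike.ext _ _ fun x => ?_
  by_contra hx
  set w := wordAct f L
  have hcl : IsClosed {z | w z = z ∧ z ≤ x} :=
    (isClosed_eq w.continuous continuous_id).inter isClosed_Iic
  have hne : {z | w z = z ∧ z ≤ x}.Nonempty := ⟨⊥, w.map_bot, bot_le⟩
  have hc := hcl.csSup_mem hne (OrderTop.bddAbove _)
  set c := sSup {z | w z = z ∧ z ≤ x}
  have hcx : c < x := lt_of_le_of_ne hc.2 fun h => hx (h ▸ hc.1)
  have hev := P.eventually_fix H hc.1
  have : (𝓝[>] c).NeBot := nhdsGT_neBot_of_exists_gt ⟨x, hcx⟩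
  obtain ⟨y, hy1, hy2, hy3⟩ := (hev.and (Ioo_mem_nhdsGT hcx)).exists
  exact absurd (le_csSup (OrderTop.bddAbove _) (show y ∈ {z | w z = z ∧ z ≤ x} from
    ⟨hy1, hy3.le⟩)) (not_le.2 hy2)

/-! ### Realizing abstract histories -/

/-- The combinatorial condition on a list of feet to be a history. -/
def IsChainList (D : ι → Foot ι → ℕ) (h : List (Foot ι)) : Prop :=
  h.IsChain fun φ ψ => 1 ≤ φ.num ∧ φ.num = D φ.idx ψ ∧ ¬(ψ.idx = φ.idx ∧ ψ.out = !φ.out)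

lemma Hist.isChainList {x x₀ : unitInterval} {h : List (Foot ι)} (H : P.Hist x h x₀) :
    IsChainList D h := by
  induction H with
  | nil => exact List.isChain_nil
  | @cons x h x₀ φ hx ho hf ih =>
    cases h with
    | nil => exact List.isChain_singleton _
    | cons ψ h =>
      have hm := hx.mem_foot
      have hD : φ.num = D φ.idx ψ := by
        by_cases h0 : D φ.idx ψ = 0
        · exact absurd ho (P.loc_zero hm h0 _)
        · exact P.orb_disj ho (P.loc_pos hm h0)
      refine List.isChain_cons_cons.2 ⟨⟨(P.orb_valid ho).1, hD, fun h1 => hf ?_⟩, ih⟩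
      have : φ.opp = ψ := by
        obtain ⟨i, k, e⟩ := ψ
        obtain ⟨i', k', e'⟩ := φ
        dsimp only at h1
        obtain ⟨rfl, rfl⟩ := h1
        have := P.D_self ⟨i, k, !e'⟩
        simp_all [Foot.opp]
      rwa [this]

lemma Hist.getLast_valid {x x₀ : unitInterval} {h : List (Foot ι)} (H : P.Hist x h x₀) :
    ∀ φ ∈ h.getLast?, 1 ≤ φ.num := by
  induction H with
  | nil => simp
  | @cons x h x₀ φ hx ho hf ih =>
    cases h with
    | nil => simpa using (P.orb_valid ho).1
    | cons ψ h => simpa using ih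

lemma exists_hist_of_isChainList {h : List (Foot ι)} (hh : IsChainList D h) {φ : Foot ι}
    (hl : φ ∈ h.getLast?) {y : unitInterval} (hy : y ∈ P.orb φ.idx φ.num)
    (hy' : y ∉ P.foot φ.opp) : ∃ x, P.Hist x h y := by
  induction h with
  | nil => simp at hl
  | cons χ h ih =>
    cases h with
    | nil =>
      simp only [List.getLast?_singleton, Option.mem_some_iff] at hl
      subst hl
      exact ⟨_, .cons χ (.nil y) hy hy'⟩
    | cons ψ h =>
      obtain ⟨⟨h1, h2, h3⟩, h4⟩ := List.isChain_cons_cons.1 hh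
      obtain ⟨x, hx⟩ := ih h4 (by simpa using hl)
      refine ⟨_, .cons χ hx ?_ fun h5 => h3 ?_⟩
      · rw [h2]
        exact P.loc_pos hx.mem_foot (by omega)
      · have := P.foot_disj hx.mem_foot h5
        rw [this]
        exact ⟨rfl, rfl⟩

/-- A trivial word acts trivially on every realizable history that is longer than the word. -/
theorem pushWord_eq_of_wordAct_eq_one {L : List (ι × Bool)} (hL : wordAct f L = 1)
    {h : List (Foot ι)} (hh : IsChainList D h) (hlen : L.length ≤ h.length) {φ : Foot ι}
    (hl : φ ∈ h.getLast?) (h1 : 1 ≤ φ.num) (hn : φ.num ≤ P.n φ.idx) : pushWord D 0 L h = h := by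
  obtain ⟨y₀, y₁, a0, b0, a1, b1, hsep⟩ := P.sep φ h1 hn
  obtain ⟨x, hx⟩ := exists_hist_of_isChainList hh hl a0 b0
  obtain ⟨x', hx'⟩ := exists_hist_of_isChainList hh hl a1 b1
  have e := hx.word (β := 0) L (.inl hlen)
  have e' := hx'.word (β := 0) L (.inl hlen)
  rw [hL] at e e'
  exact Hist.unique hsep e hx e' hx'

end PingPong

/-! ### Changing the tail of a history -/

section Tail

variable {D : ι → Foot ι → ℕ} {i : ι} {κ m : ℕ} {ε : Bool}

/-- A letter acts in the same way on two histories that differ only in their constant tails, if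
the feet of the tails belong to the same function and look alike to all other functions. If these
feet differ in direction, then one tail grows as the other shrinks. -/
lemma push_append_replicate (hself : ∀ φ : Foot ι, D φ.idx φ = φ.num)
    (hD : ∀ j, j ≠ i → D j ⟨i, κ, ε⟩ = D j ⟨i, m, false⟩) (hκ : κ ≠ 0) (hm : m ≠ 0)
    (a : ι × Bool) {l : List (Foot ι)} {p q : ℕ} (hl : ∀ χ ∈ l.getLast?, χ.idx ≠ i)
    (hp : l ≠ [] ∨ 1 ≤ p) (hq : 1 ≤ q) :
    ∃ l' p' q', push D 0 a (l ++ List.replicate p ⟨i, κ, ε⟩) = l' ++ List.replicate p' ⟨i, κ, ε⟩ ∧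
      push D 0 a (l ++ List.replicate q ⟨i, m, false⟩) = l' ++ List.replicate q' ⟨i, m, false⟩ ∧
      (∀ χ ∈ l'.getLast?, χ.idx ≠ i) ∧
      (q' : ℤ) - q = (bif ε then -1 else 1) * ((p' : ℤ) - p) ∧ q ≤ q' + 1 := by
  obtain ⟨j, b⟩ := a
  cases l with
  | nil =>
    obtain ⟨p, rfl⟩ : ∃ p', p = p' + 1 := ⟨p - 1, by have := hp.resolve_left (by simp); omega⟩
    obtain ⟨q, rfl⟩ : ∃ q', q = q' + 1 := ⟨q - 1, by omega⟩
    by_cases hj : j = i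
    · subst hj
      have e1 := hself ⟨j, κ, ε⟩
      have e2 := hself ⟨j, m, false⟩
      dsimp only at e1 e2
      have r1 : ∀ (p : ℕ) (φ : Foot ι), [] ++ List.replicate (p + 1) φ =
          φ :: List.replicate p φ := fun p φ => by simp [List.replicate_succ]
      simp only [r1, push, e1, e2, hκ, hm, if_false, true_and]
      cases ε <;> cases b
      · exact ⟨[], p + 2, q + 2, by simp [List.replicate_succ], by simp [List.replicate_succ],
          by simp, by simp, by omega⟩
      · exact ⟨[], p, q, by simp, by simp, by simp, by simp, by omega⟩
      · exact ⟨[], p, q + 2, by simp, by simp [List.replicate_succ], by simp,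
          by simp, by omega⟩
      · exact ⟨[], p + 2, q, by simp [List.replicate_succ], by simp, by simp,
          by simp, by omega⟩
    · have e1 := hD j hj
      simp only [List.nil_append, List.replicate_succ, push, e1, Ne.symm hj, false_and, if_false]
      by_cases h0 : D j ⟨i, m, false⟩ = 0
      · exact ⟨[], p + 1, q + 1, by simp [h0, List.replicate_succ],
          by simp [h0, List.replicate_succ], by simp, by simp, by omega⟩
      · exact ⟨[⟨j, D j ⟨i, m, false⟩, b⟩], p + 1, q + 1, by simp [h0, List.replicate_succ],
          by simp [h0, List.replicate_succ], by simpa using hj, by simp, by omega⟩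
  | cons χ l =>
    simp only [List.cons_append, push]
    split_ifs with h0 h1
    · exact ⟨χ :: l, p, q, rfl, rfl, hl, by simp, by omega⟩
    · refine ⟨l, p, q, rfl, rfl, fun χ' h => hl χ' ?_, by simp, by omega⟩
      cases l with
      | nil => simp at h
      | cons _ _ => simpa using h
    · exact ⟨_ :: χ :: l, p, q, rfl, rfl, by simpa using hl, by simp, by omega⟩

lemma pushWord_append_replicate (hself : ∀ φ : Foot ι, D φ.idx φ = φ.num)
    (hD : ∀ j, j ≠ i → D j ⟨i, κ, ε⟩ = D j ⟨i, m, false⟩) (hκ : κ ≠ 0) (hm : m ≠ 0)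
    (L : List (ι × Bool)) {l : List (Foot ι)} {p q : ℕ} (hl : ∀ χ ∈ l.getLast?, χ.idx ≠ i)
    (hp : L.length ≤ l.length + p) (hq : L.length ≤ q) :
    ∃ l' p' q',
      pushWord D 0 L (l ++ List.replicate p ⟨i, κ, ε⟩) = l' ++ List.replicate p' ⟨i, κ, ε⟩ ∧
      pushWord D 0 L (l ++ List.replicate q ⟨i, m, false⟩) =
        l' ++ List.replicate q' ⟨i, m, false⟩ ∧
      (∀ χ ∈ l'.getLast?, χ.idx ≠ i) ∧
      (q' : ℤ) - q = (bif ε then -1 else 1) * ((p' : ℤ) - p) ∧ q ≤ q' + L.length := by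
  induction L with
  | nil => exact ⟨l, p, q, rfl, rfl, hl, by simp, by simp⟩
  | cons a L ih =>
    rw [List.length_cons] at hp hq
    obtain ⟨l₁, p₁, q₁, h1, h2, h3, h4, h5⟩ := ih (by omega) (by omega)
    have hlen := PingPong.length_pushWord (D := D) 0 L (l ++ List.replicate p ⟨i, κ, ε⟩)
    rw [h1] at hlen
    simp only [List.length_append, List.length_replicate] at hlen
    obtain ⟨l₂, p₂, q₂, k1, k2, k3, k4, k5⟩ :=
      push_append_replicate hself hD hκ hm a (l := l₁) (p := p₁) (q := q₁) h3
        (by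
          rcases l₁ with _ | ⟨χ, l₁⟩
          · right; simp at hlen; omega
          · left; simp)
        (by omega)
    refine ⟨l₂, p₂, q₂, ?_, ?_, k3, ?_, by rw [List.length_cons]; omega⟩
    · rw [pushWord] at h1 ⊢
      rw [List.foldr_cons, h1, k1]
    · rw [pushWord] at h2 ⊢
      rw [List.foldr_cons, h2, k2]
    · cases ε <;> simp at * <;> omega

lemma append_replicate_inj {α : Type*} {ψ : α} {l l' : List α} {q q' : ℕ}
    (hl : ψ ∉ l.getLast?) (hl' : ψ ∉ l'.getLast?)
    (h : l ++ List.replicate q ψ = l' ++ List.replicate q' ψ) : l = l' ∧ q = q' := by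
  induction q generalizing q' with
  | zero =>
    cases q' with
    | zero => simpa using h
    | succ q' =>
      rw [List.replicate_succ', ← List.append_assoc] at h
      simp only [List.replicate_zero, List.append_nil] at h
      simp [h] at hl
  | succ q ih =>
    cases q' with
    | zero =>
      rw [List.replicate_succ', ← List.append_assoc] at h
      simp only [List.replicate_zero, List.append_nil] at h
      simp [← h] at hl'
    | succ q' =>
      rw [List.replicate_succ', List.replicate_succ', ← List.append_assoc,
        ← List.append_assoc] at h
      obtain ⟨h1, h2⟩ := ih (List.append_cancel_right h)
      exact ⟨h1, by omega⟩

/-- The maximal constant tail of a history. -/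
lemma IsChainList.exists_tail (hself : ∀ φ : Foot ι, D φ.idx φ = φ.num) {h : List (Foot ι)}
    (hh : PingPong.IsChainList D h) {φ : Foot ι} (hl : φ ∈ h.getLast?) :
    ∃ l p, h = l ++ List.replicate (p + 1) φ ∧ ∀ χ ∈ l.getLast?, χ.idx ≠ φ.idx := by
  induction h with
  | nil => simp at hl
  | cons χ h ih =>
    cases h with
    | nil =>
      simp only [List.getLast?_singleton, Option.mem_some_iff] at hl
      subst hl
      exact ⟨[], 0, rfl, by simp⟩
    | cons ψ h =>
      obtain ⟨⟨h1, h2, h3⟩, h4⟩ := List.isChain_cons_cons.1 hh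
      obtain ⟨l, p, e, hlast⟩ := ih h4 (by simpa using hl)
      cases l with
      | cons ψ' l => exact ⟨χ :: ψ' :: l, p, by rw [e]; rfl, by simpa using hlast⟩
      | nil =>
        by_cases hi : χ.idx = φ.idx
        · refine ⟨[], p + 1, ?_, by simp⟩
          have hψ : ψ = φ := by
            simp only [List.nil_append, List.replicate_succ, List.cons.injEq] at e
            exact e.1
          have : χ = φ := by
            subst hψ
            rw [hi, hself] at h2
            obtain ⟨i, k, b⟩ := χ
            obtain ⟨i', k', b'⟩ := ψ
            dsimp only at hi h2 h3
            subst hi h2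
            cases b <;> cases b' <;> simp_all
          rw [e, this]
          rfl
        · exact ⟨[χ], p, by rw [e]; rfl, by simpa using hi⟩

end Tail

/-! ### Comparing two ping-pong systems -/

/-- Two ping-pong systems with the same combinatorics have the same relations. They may differ in
the number of orbitals; a bump that is missing in the second one may be replaced by the inner
foot of the innermost bump of the same function that is present. -/
theorem PingPong.wordAct_eq_one [Finite ι] {f g : ι → HomeoPlus} {D : ι → Foot ι → ℕ}
    (P : PingPong f D) (Q : PingPong g D) {L : List (ι × Bool)} (hL : wordAct g L = 1) :
    wordAct f L = 1 := by
  by_contra hne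
  obtain ⟨x, h, x₀, hist, hlen, hpush⟩ := P.exists_deep_hist hne
  have hc := hist.isChainList
  have hnil : h ≠ [] := by rintro rfl; simp at hlen
  obtain ⟨φ, hφ⟩ : ∃ φ, φ ∈ h.getLast? := ⟨_, List.getLast?_eq_some_getLast hnil⟩
  have h1 := hist.getLast_valid φ hφ
  by_cases hn : φ.num ≤ Q.n φ.idx
  · exact hpush (pushWord_eq_of_wordAct_eq_one hL hc hlen.le hφ h1 hn)
  obtain ⟨l, p, rfl, hlast⟩ := IsChainList.exists_tail P.D_self hc hφ
  obtain ⟨i, κ, ε⟩ := φ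
  dsimp only at *
  have hm := Q.n_pos i
  have hD : ∀ j, j ≠ i → D j ⟨i, κ, ε⟩ = D j ⟨i, Q.n i, false⟩ :=
    fun j hj => Q.sat hj (by omega)
  simp only [List.length_append, List.length_replicate] at hlen
  obtain ⟨l', p', q', e1, e2, e3, e4, -⟩ :=
    pushWord_append_replicate P.D_self hD (by omega) (by omega) L (q := L.length + 1) hlast
      hlen.le (by omega)
  -- The history with the tail replaced is realizable in the second system.
  have hc' : IsChainList D (l ++ List.replicate (L.length + 1) ⟨i, Q.n i, false⟩) := by
    rw [IsChainList, List.isChain_append] at hc ⊢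
    refine ⟨hc.1, List.isChain_replicate_of_rel _ ⟨hm, (P.D_self ⟨i, Q.n i, false⟩).symm,
      by simp⟩, fun χ hχ ψ hψ => ?_⟩
    have h2 := hc.2.2 χ hχ ⟨i, κ, ε⟩ (by simp [List.replicate_succ])
    have hi := hlast χ hχ
    obtain rfl : (⟨i, Q.n i, false⟩ : Foot ι) = ψ := by
      simpa [List.replicate_succ] using hψ
    rw [hD _ hi] at h2
    exact ⟨h2.1, h2.2.1, fun h => hi h.1.symm⟩
  have h3 := Q.pushWord_eq_of_wordAct_eq_one hL hc' (by simp; omega)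
    (φ := ⟨i, Q.n i, false⟩) (by simp [List.replicate_succ']) hm le_rfl
  rw [e2] at h3
  obtain ⟨rfl, h4⟩ := append_replicate_inj (fun h => e3 _ h rfl) (fun h => hlast _ h rfl) h3
  apply hpush
  rw [e1]
  have : p' = p + 1 := by
    subst h4
    cases ε <;> simp at e4 <;> omega
  rw [this]

/-! ### Orbitals -/

section Orbitals

variable {f : HomeoPlus}

lemma exists_mem_orbital {t : unitInterval} (ht : f t ≠ t) :
    ∃ p ∈ orbitals f, t ∈ Ioo p.1 p.2 := by
  have hcl : IsClosed {z | f z = z} := isClosed_eq f.continuous continuous_id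
  have h1 := (hcl.inter (isClosed_Iic (a := t))).csSup_mem ⟨⊥, f.map_bot, mem_Iic.2 bot_le⟩
    (OrderTop.bddAbove _)
  have h2 := (hcl.inter (isClosed_Ici (a := t))).csInf_mem ⟨⊤, f.map_top, mem_Ici.2 le_top⟩
    (OrderBot.bddBelow _)
  set u := sSup ({z | f z = z} ∩ Iic t)
  set v := sInf ({z | f z = z} ∩ Ici t)
  have hut : u < t := lt_of_le_of_ne h1.2 fun h => ht (h ▸ h1.1)
  have htv : t < v := lt_of_le_of_ne h2.2 fun h => ht (h ▸ h2.1)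
  refine ⟨(u, v), ⟨hut.trans htv, h1.1, h2.1, fun s hs hfs => ?_⟩, hut, htv⟩
  rcases le_total s t with h | h
  · exact absurd (le_csSup (OrderTop.bddAbove _) (show s ∈ {z | f z = z} ∩ Iic t from ⟨hfs, h⟩)) (not_le.2 hs.1)
  · exact absurd (csInf_le (OrderBot.bddBelow _) (show s ∈ {z | f z = z} ∩ Ici t from ⟨hfs, h⟩)) (not_le.2 hs.2)

/-- A fixed point is not in the interior of an orbital. -/
lemma le_or_le_of_fix {p : unitInterval × unitInterval} (hp : p ∈ orbitals f) {x : unitInterval}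
    (hx : f x = x) : x ≤ p.1 ∨ p.2 ≤ x := by
  by_contra! h
  exact hp.2.2.2 x h hx

lemma orbitals_eq_of_mem {p q : unitInterval × unitInterval} (hp : p ∈ orbitals f)
    (hq : q ∈ orbitals f) {t : unitInterval} (h1 : t ∈ Ioo p.1 p.2) (h2 : t ∈ Ioo q.1 q.2) :
    p = q := by
  have a1 := (le_or_le_of_fix hq hp.2.1).resolve_right (not_le.2 (h1.1.trans h2.2))
  have a2 := (le_or_le_of_fix hp hq.2.1).resolve_right (not_le.2 (h2.1.trans h1.2))
  have b1 := (le_or_le_of_fix hq hp.2.2.1).resolve_left (not_le.2 (h2.1.trans h1.2))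
  have b2 := (le_or_le_of_fix hp hq.2.2.1).resolve_left (not_le.2 (h1.1.trans h2.2))
  exact Prod.ext (le_antisymm a1 a2) (le_antisymm b2 b1)

lemma mem_posOrbitals_or_negOrbitals {p : unitInterval × unitInterval} (hp : p ∈ orbitals f) :
    p ∈ posOrbitals f ∨ p ∈ negOrbitals f := by
  by_contra! h
  simp only [posOrbitals, negOrbitals, mem_ofPred_eq, hp, true_and] at h
  push Not at h
  obtain ⟨⟨s, hs, hs'⟩, t, ht, ht'⟩ := h
  obtain ⟨x, hx, hx'⟩ := isPreconnected_Ioo.intermediate_value₂ hs ht f.continuous.continuousOn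
    continuous_id.continuousOn hs' ht'
  exact hp.2.2.2 x hx hx'

lemma not_mem_negOrbitals {p : unitInterval × unitInterval} (hp : p ∈ posOrbitals f) :
    p ∉ negOrbitals f := fun h => by
  obtain ⟨t, ht⟩ := exists_between hp.1.1
  exact lt_asymm (hp.2 t ht) (h.2 t ht)

lemma Ioo_subset_extSupp {p : unitInterval × unitInterval} (hp : p ∈ orbitals f) :
    Ioo (p.1 : ℝ) p.2 ⊆ extSupp f := by
  refine interior_maximal (fun x hx => subset_closure ?_) isOpen_Ioo
  have hx' : x ∈ Icc (0 : ℝ) 1 := ⟨p.1.2.1.trans hx.1.le, hx.2.le.trans p.2.2.2⟩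
  exact ⟨⟨x, hx'⟩, hp.2.2.2 _ ⟨hx.1, hx.2⟩, rfl⟩

lemma fix_of_mem_transitionPoints {x : unitInterval} (hx : x ∈ transitionPoints f) : f x = x := by
  obtain ⟨p, hp, rfl | rfl⟩ := hx
  exacts [hp.2.1, hp.2.2.1]

lemma finite_transitionPoints (hf : (orbitals f).Finite) : (transitionPoints f).Finite := by
  have : transitionPoints f = Prod.fst '' orbitals f ∪ Prod.snd '' orbitals f := by
    ext x
    simp only [transitionPoints, mem_ofPred_eq, mem_union, mem_image]
    constructor
    · rintro ⟨p, hp, rfl | rfl⟩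
      exacts [.inl ⟨p, hp, rfl⟩, .inr ⟨p, hp, rfl⟩]
    · rintro (⟨p, hp, rfl⟩ | ⟨p, hp, rfl⟩)
      exacts [⟨p, hp, .inl rfl⟩, ⟨p, hp, .inr rfl⟩]
  rw [this]
  exact (hf.image _).union (hf.image _)

/-- If the extended support is an interval, then there is no fixed point inside it but the
transition points. -/
lemma mem_transitionPoints_of_fix (hfin : (orbitals f).Finite) (hI : (extSupp f).OrdConnected)
    {t : unitInterval} {p q : unitInterval × unitInterval} (hp : p ∈ orbitals f)
    (hq : q ∈ orbitals f) (hpt : p.1 < t) (htq : t < q.2) (ht : f t = t) :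
    t ∈ transitionPoints f := by
  by_contra hT
  have h1 := (le_or_le_of_fix hp ht).resolve_left (not_le.2 hpt)
  have h2 := (le_or_le_of_fix hq ht).resolve_right (not_le.2 htq)
  obtain ⟨x, hx⟩ := exists_between (show (p.1 : ℝ) < p.2 from hp.1)
  obtain ⟨y, hy⟩ := exists_between (show (q.1 : ℝ) < q.2 from hq.1)
  have h3 : (t : ℝ) ∈ extSupp f := hI.out (Ioo_subset_extSupp hp hx) (Ioo_subset_extSupp hq hy)
    ⟨hx.2.le.trans h1, le_trans h2 hy.1.le⟩
  have h4 := interior_subset h3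
  have hcl : IsClosed (⋃ r ∈ orbitals f, Icc (r.1 : ℝ) r.2) :=
    hfin.isClosed_biUnion fun r _ => isClosed_Icc
  have hsub : (fun t : unitInterval => (t : ℝ)) '' supp f ⊆
      ⋃ r ∈ orbitals f, Icc (r.1 : ℝ) r.2 := by
    rintro _ ⟨s, hs, rfl⟩
    obtain ⟨r, hr, hsr⟩ := exists_mem_orbital hs
    exact mem_biUnion hr ⟨hsr.1.le, hsr.2.le⟩
  obtain ⟨r, hr, h5⟩ := mem_iUnion₂.1 (closure_minimal hsub hcl h4)
  rcases le_or_le_of_fix hr ht with h | h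
  · exact hT ⟨r, hr, .inl (le_antisymm h h5.1)⟩
  · exact hT ⟨r, hr, .inr (le_antisymm h5.2 h)⟩

/-- The orbitals of a function whose extended support is an interval form a contiguous sequence. -/
lemma exists_orbitals_sequence (hfin : (orbitals f).Finite) (hne : (orbitals f).Nonempty)
    (hI : (extSupp f).OrdConnected) : ∃ (m : ℕ) (Y : ℕ → unitInterval), 1 ≤ m ∧
      (∀ j l, j < l → l ≤ m → Y j < Y l) ∧
      ∀ p, p ∈ orbitals f ↔ ∃ j < m, p = (Y j, Y (j + 1)) := by
  classical
  set F := (finite_transitionPoints hfin).toFinset with hF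
  have hFmem : ∀ x, x ∈ F ↔ x ∈ transitionPoints f := fun x => by simp [hF]
  obtain ⟨p₀, hp₀⟩ := hne
  have hcard : 1 < F.card :=
    Finset.one_lt_card.2 ⟨p₀.1, (hFmem _).2 ⟨p₀, hp₀, .inl rfl⟩, p₀.2,
      (hFmem _).2 ⟨p₀, hp₀, .inr rfl⟩, hp₀.1.ne⟩
  obtain ⟨m, hm⟩ : ∃ m, F.card = m + 1 := ⟨F.card - 1, by omega⟩
  set y := F.orderEmbOfFin hm
  set Y : ℕ → unitInterval := fun j => y ⟨min j m, by omega⟩ with hY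
  have hYlt : ∀ j l, j < l → l ≤ m → Y j < Y l := fun j l h1 h2 =>
    y.strictMono (by simp only [Fin.lt_def]; omega)
  have hYle : ∀ j l, j ≤ l → Y j ≤ Y l := fun j l h1 =>
    y.monotone (by simp only [Fin.le_def]; omega)
  have hYmem : ∀ j, Y j ∈ transitionPoints f := fun j =>
    (hFmem _).1 (F.orderEmbOfFin_mem hm _)
  have hYsurj : ∀ x ∈ transitionPoints f, ∃ j ≤ m, Y j = x := fun x hx => by
    have : x ∈ Set.range y := by
      rw [Finset.range_orderEmbOfFin]
      exact (hFmem x).2 hx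
    obtain ⟨⟨j, hj⟩, rfl⟩ := this
    exact ⟨j, by omega, by simp only [hY]; congr 1; ext; simp; omega⟩
  refine ⟨m, Y, by omega, hYlt, fun p => ⟨fun hp => ?_, ?_⟩⟩
  · obtain ⟨j, hj, hj'⟩ := hYsurj _ ⟨p, hp, .inl rfl⟩
    obtain ⟨l, hl, hl'⟩ := hYsurj _ ⟨p, hp, .inr rfl⟩
    have hjl : j < l := by
      by_contra! h
      have := hYle _ _ h
      rw [hj', hl'] at this
      exact absurd hp.1 (not_lt.2 this)
    refine ⟨j, by omega, Prod.ext hj'.symm ?_⟩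
    have h1 := hYlt j (j + 1) (by omega) (by omega)
    have h2 := hYle (j + 1) l hjl
    rw [hj'] at h1
    rw [hl'] at h2
    rcases le_or_le_of_fix hp (fix_of_mem_transitionPoints (hYmem (j + 1))) with h | h
    · exact absurd h1 (not_lt.2 h)
    · exact le_antisymm h h2
  · rintro ⟨j, hj, rfl⟩
    refine ⟨hYlt _ _ (by omega) (by omega), fix_of_mem_transitionPoints (hYmem _),
      fix_of_mem_transitionPoints (hYmem _), fun t ht hft => ?_⟩
    have h1 : ∃ p ∈ orbitals f, p.1 < t := by
      obtain ⟨p, hp, h | h⟩ := hYmem j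
      · exact ⟨p, hp, h ▸ ht.1⟩
      · exact ⟨p, hp, hp.1.trans (h ▸ ht.1)⟩
    have h2 : ∃ p ∈ orbitals f, t < p.2 := by
      obtain ⟨p, hp, h | h⟩ := hYmem (j + 1)
      · exact ⟨p, hp, lt_trans (h ▸ ht.2) hp.1⟩
      · exact ⟨p, hp, h ▸ ht.2⟩
    obtain ⟨p, hp, hpt⟩ := h1
    obtain ⟨q, hq, hqt⟩ := h2
    obtain ⟨l, hl, rfl⟩ := hYsurj _ (mem_transitionPoints_of_fix hfin hI hp hq hpt hqt hft)
    rcases le_or_gt l j with h | h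
    · exact absurd ht.1 (not_lt.2 (hYle _ _ h))
    · exact absurd ht.2 (not_lt.2 (hYle _ _ h))

end Orbitals

/-! ### Spirals -/

/-- The orbital number `k ≥ 1` of a standard function with the spiral `z`. -/
def spiralOrb (z : ℕ → unitInterval) (k : ℕ) : unitInterval × unitInterval :=
  if Odd k then (z (k + 1), z (k - 1)) else (z (k - 1), z (k + 1))

/-- The orbitals of a standard function, numbered from the outside to the inside, are alternately
the rightmost and the leftmost of those that remain. The transition points in the corresponding
order form a spiral `z 0 > z 2 > ⋯` and `z 1 < z 3 < ⋯`, which is continued as a constant sequence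
from the last point `z n` on. -/
structure IsSpiral (f : HomeoPlus) (n : ℕ) (z : ℕ → unitInterval) : Prop where
  n_pos : 1 ≤ n
  const : ∀ k, n ≤ k → z k = z n
  orbitals_eq : orbitals f = spiralOrb z '' Icc 1 n
  pos : ∀ k, 1 ≤ k → k ≤ n → Odd k → spiralOrb z k ∈ posOrbitals f
  neg : ∀ k, 1 ≤ k → k ≤ n → Even k → spiralOrb z k ∈ negOrbitals f

theorem IsStandard.exists_isSpiral {f : MarkedFun} (hf : IsStandard f) :
    ∃ n z, IsSpiral f.toHomeo n z := by
  classical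
  obtain ⟨m, Y, hm, hY, horb⟩ := exists_orbitals_sequence hf.finite hf.nonempty hf.interval
  set o : ℕ → unitInterval × unitInterval := fun j => (Y j, Y (j + 1)) with ho
  have hmem : ∀ j < m, o j ∈ orbitals f.toHomeo := fun j hj => (horb _).2 ⟨j, hj, rfl⟩
  have hinj : ∀ j < m, ∀ l < m, o j = o l → j = l := fun j hj l hl h => by
    have h1 : Y j = Y l := congrArg Prod.fst h
    rcases lt_trichotomy j l with h2 | h2 | h2
    · exact absurd h1 (hY _ _ h2 hl.le).ne
    · exact h2
    · exact absurd h1 (hY _ _ h2 hj.le).ne'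
  -- The first positive orbital, if there is one, separates negative and positive orbitals.
  have hex : ∃ c, c = m ∨ o c ∈ posOrbitals f.toHomeo := ⟨m, .inl rfl⟩
  set c := Nat.find hex with hc
  have hcm : c ≤ m := Nat.find_min' hex (.inl rfl)
  have hneg : ∀ j < c, o j ∈ negOrbitals f.toHomeo := fun j hj =>
    (mem_posOrbitals_or_negOrbitals (hmem j (by omega))).resolve_left
      fun h => Nat.find_min hex hj (.inr h)
  have hpos : ∀ j, c ≤ j → j < m → o j ∈ posOrbitals f.toHomeo := fun j h1 h2 => by
    have h3 := (Nat.find_spec hex).resolve_left (by omega)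
    refine (mem_posOrbitals_or_negOrbitals (hmem j h2)).resolve_right fun h4 => ?_
    have h5 := hf.neg_left_pos _ h4 _ h3
    simp only [ho] at h5
    have h6 : Y c ≤ Y j := by
      rcases h1.eq_or_lt with h | h
      · rw [h]
      · exact (hY _ _ h h2.le).le
    exact absurd (hY j (j + 1) (by omega) (by omega)) (not_lt.2 (h5.trans h6))
  have hnegset : negOrbitals f.toHomeo = o '' (Finset.range c : Set ℕ) := by
    ext p
    constructor
    · intro hp
      obtain ⟨j, hj, rfl⟩ := (horb p).1 hp.1
      refine ⟨j, ?_, rfl⟩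
      by_contra h
      simp only [Finset.coe_range, mem_Iio, not_lt] at h
      exact not_mem_negOrbitals (hpos j h hj) hp
    · rintro ⟨j, hj, rfl⟩
      exact hneg j (by simpa using hj)
  have hposset : posOrbitals f.toHomeo = o '' (Finset.Ico c m : Set ℕ) := by
    ext p
    constructor
    · intro hp
      obtain ⟨j, hj, rfl⟩ := (horb p).1 hp.1
      refine ⟨j, ?_, rfl⟩
      by_contra h
      simp only [Finset.coe_Ico, mem_Ico, not_and, not_lt] at h
      refine not_mem_negOrbitals hp (hneg j ?_)
      by_contra h'
      have := h (by omega)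
      omega
    · rintro ⟨j, hj, rfl⟩
      simp only [Finset.coe_Ico, mem_Ico] at hj
      exact hpos j hj.1 hj.2
  have hnc : (negOrbitals f.toHomeo).ncard = c := by
    rw [hnegset, InjOn.ncard_image, Set.ncard_coe_finset, Finset.card_range]
    intro j hj l hl h
    simp only [Finset.coe_range, mem_Iio] at hj hl
    exact hinj j (by omega) l (by omega) h
  have hpc : (posOrbitals f.toHomeo).ncard = m - c := by
    rw [hposset, InjOn.ncard_image, Set.ncard_coe_finset, Nat.card_Ico]
    intro j hj l hl h
    simp only [Finset.coe_Ico, mem_Ico] at hj hl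
    exact hinj j (by omega) l (by omega) h
  have h1 := hf.neg_le_pos
  have h2 := hf.pos_le_neg
  rw [hnc, hpc] at h1 h2
  have hcm2 : c = m / 2 := by omega
  clear_value c
  set z : ℕ → unitInterval := fun k =>
    if Even k then Y (max (m - k / 2) (m / 2)) else Y (min (k / 2) (m / 2)) with hz
  have hze : ∀ k, Even k → z k = Y (max (m - k / 2) (m / 2)) := fun k hk => if_pos hk
  have hzo : ∀ k, ¬ Even k → z k = Y (min (k / 2) (m / 2)) := fun k hk => if_neg hk
  have hodd : ∀ k, 1 ≤ k → k ≤ m → Odd k → spiralOrb z k = o (m - 1 - k / 2) := by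
    rintro k hk1 hk2 hk
    obtain ⟨a, rfl⟩ := hk
    rw [spiralOrb, if_pos ⟨a, rfl⟩, hze _ ⟨a + 1, by omega⟩, hze _ ⟨a, by omega⟩, ho]
    congr 2 <;> omega
  have heven : ∀ k, 1 ≤ k → k ≤ m → Even k → spiralOrb z k = o (k / 2 - 1) := by
    rintro k hk1 hk2 hk
    rw [spiralOrb, if_neg (by simpa using hk), hzo _ (by grind), hzo _ (by grind), ho]
    obtain ⟨a, rfl⟩ := hk
    congr 2 <;> omega
  refine ⟨m, z, hm, fun k hk => ?_, ?_, fun k hk1 hk2 hk => ?_, fun k hk1 hk2 hk => ?_⟩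
  · have key : ∀ k, m ≤ k → z k = Y (m / 2) := fun k hk => by
      by_cases hk' : Even k
      · rw [hze k hk']
        obtain ⟨a, rfl⟩ := hk'
        congr 1; omega
      · rw [hzo k hk']
        obtain ⟨a, rfl⟩ := Nat.not_even_iff_odd.1 hk'
        congr 1; omega
    rw [key k hk, key m le_rfl]
  · ext p
    rw [horb]
    constructor
    · rintro ⟨j, hj, rfl⟩
      rcases lt_or_ge j (m / 2) with h | h
      · refine ⟨2 * (j + 1), ⟨by omega, by omega⟩, ?_⟩
        rw [heven _ (by omega) (by omega) ⟨j + 1, by omega⟩]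
        change o _ = o j
        congr 1; omega
      · refine ⟨2 * (m - 1 - j) + 1, ⟨by omega, by omega⟩, ?_⟩
        rw [hodd _ (by omega) (by omega) ⟨_, rfl⟩]
        change o _ = o j
        congr 1; omega
    · rintro ⟨k, ⟨hk1, hk2⟩, rfl⟩
      rcases Nat.even_or_odd k with h | h
      · exact ⟨k / 2 - 1, by omega, heven k hk1 hk2 h⟩
      · exact ⟨m - 1 - k / 2, by omega, hodd k hk1 hk2 h⟩
  · rw [hodd k hk1 hk2 hk]
    obtain ⟨a, rfl⟩ := hk
    exact hpos (m - 1 - (2 * a + 1) / 2) (by omega) (by omega)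
  · rw [heven k hk1 hk2 hk]
    obtain ⟨a, rfl⟩ := hk
    exact hneg ((a + a) / 2 - 1) (by omega)

namespace IsSpiral

variable {f : HomeoPlus} {n : ℕ} {z : ℕ → unitInterval} (hz : IsSpiral f n z)
include hz

lemma mem_orbitals {k : ℕ} (h1 : 1 ≤ k) (h2 : k ≤ n) : spiralOrb z k ∈ orbitals f := by
  rw [hz.orbitals_eq]
  exact ⟨k, ⟨h1, h2⟩, rfl⟩

lemma lt_of_even {k : ℕ} (hk : Even k) (hn : k < n) : z (k + 2) < z k := by
  have := (hz.mem_orbitals (k := k + 1) (by omega) (by omega)).1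
  rwa [spiralOrb, if_pos (by grind)] at this

lemma lt_of_odd {k : ℕ} (hk : Odd k) (hn : k < n) : z k < z (k + 2) := by
  have := (hz.mem_orbitals (k := k + 1) (by omega) (by omega)).1
  rwa [spiralOrb, if_neg (by grind)] at this

lemma add_two_eq {k : ℕ} (hn : n ≤ k) : z (k + 2) = z k := by
  rw [hz.const k hn, hz.const (k + 2) (by omega)]

lemma le_of_even' {k : ℕ} (hk : Even k) : z (k + 2) ≤ z k := by
  rcases lt_or_ge k n with h | h
  · exact (hz.lt_of_even hk h).le
  · exact (hz.add_two_eq h).le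

lemma le_of_odd' {k : ℕ} (hk : Odd k) : z k ≤ z (k + 2) := by
  rcases lt_or_ge k n with h | h
  · exact (hz.lt_of_odd hk h).le
  · exact (hz.add_two_eq h).ge

/-- The part of the spiral from an even index on lies to the left of the point at that index. -/
lemma le_of_even {k l : ℕ} (hk : Even k) (hkl : k ≤ l) : z l ≤ z k := by
  have key : ∀ j, z (k + 2 * j) ≤ z k := fun j => by
    induction j with
    | zero => rfl
    | succ j ih => exact (hz.le_of_even' (k := k + 2 * j) (by grind)).trans ih
  have key' : ∀ {l} (hl : Odd l) j, z l ≤ z (l + 2 * j) := fun {l} hl j => by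
    induction j with
    | zero => rfl
    | succ j ih => exact ih.trans (hz.le_of_odd' (k := l + 2 * j) (by grind))
  rcases Nat.even_or_odd l with h | h
  · obtain ⟨a, rfl⟩ := hk
    obtain ⟨b, rfl⟩ := h
    have := key (b - a)
    rwa [show a + a + 2 * (b - a) = b + b by omega] at this
  · refine (key' h n).trans (le_trans (le_of_eq ?_) (key n))
    rw [hz.const _ (by omega), hz.const (k + 2 * n) (by omega)]

/-- The part of the spiral from an odd index on lies to the right of the point at that index. -/
lemma ge_of_odd {k l : ℕ} (hk : Odd k) (hkl : k ≤ l) : z k ≤ z l := by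
  have key : ∀ j, z k ≤ z (k + 2 * j) := fun j => by
    induction j with
    | zero => rfl
    | succ j ih => exact ih.trans (hz.le_of_odd' (k := k + 2 * j) (by grind))
  rcases Nat.even_or_odd l with h | h
  · refine (key n).trans (le_trans (le_of_eq ?_) (hz.le_of_even (l := l + 2 * n) h (by omega)))
    rw [hz.const _ (by omega), hz.const (l + 2 * n) (by omega)]
  · obtain ⟨a, rfl⟩ := hk
    obtain ⟨b, rfl⟩ := h
    have := key (b - a)
    rwa [show 2 * a + 1 + 2 * (b - a) = 2 * b + 1 by omega] at this

lemma one_lt_zero : z 1 < z 0 :=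
  (hz.ge_of_odd odd_one (by omega : 1 ≤ 2)).trans_lt (hz.lt_of_even (k := 0) (by simp) hz.n_pos)

lemma le_zero (k : ℕ) : z k ≤ z 0 := hz.le_of_even (by simp) (Nat.zero_le k)

lemma one_le {k : ℕ} (hk : 1 ≤ k) : z 1 ≤ z k := hz.ge_of_odd odd_one hk

lemma one_le' (k : ℕ) : z 1 ≤ z k := by
  rcases Nat.eq_zero_or_pos k with rfl | h
  · exact hz.one_lt_zero.le
  · exact hz.one_le h

/-- An interval of the spiral that is not degenerate is an orbital. -/
lemma valid_of_lt {k : ℕ} (h : (spiralOrb z k).1 < (spiralOrb z k).2) : 1 ≤ k ∧ k ≤ n := by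
  rcases Nat.eq_zero_or_pos k with rfl | hk
  · simp only [spiralOrb, Nat.not_odd_zero, if_false] at h
    exact absurd h (not_lt.2 hz.one_lt_zero.le)
  · refine ⟨hk, ?_⟩
    by_contra! hn
    have : z (k + 1) = z (k - 1) := by
      rw [hz.const (k + 1) (by omega), hz.const (k - 1) (by omega)]
    rw [spiralOrb] at h
    split_ifs at h <;> simp [this] at h

lemma mem_orbitals_of_mem {k : ℕ} {x : unitInterval}
    (h : x ∈ Ioo (spiralOrb z k).1 (spiralOrb z k).2) : spiralOrb z k ∈ orbitals f :=
  have := hz.valid_of_lt (h.1.trans h.2)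
  hz.mem_orbitals this.1 this.2

lemma spiralOrb_injOn : InjOn (spiralOrb z) (Icc 1 n) := by
  -- The later orbitals are all to the right of an even one, and to the left of an odd one.
  have key : ∀ k l, 1 ≤ k → k < l → l ≤ n → spiralOrb z k ≠ spiralOrb z l := by
    intro k l h1 h2 h3 h
    have hp := (hz.mem_orbitals h1 (by omega)).1
    have hq := (hz.mem_orbitals (by omega) h3).1
    rcases Nat.even_or_odd k with hk | hk
    · have e1 : spiralOrb z k = (z (k - 1), z (k + 1)) := if_neg (by simpa using hk)
      have e : z (k + 1) ≤ (spiralOrb z l).1 := by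
        rw [spiralOrb]
        split_ifs with hl
        · exact hz.ge_of_odd (by grind) (by omega)
        · exact hz.ge_of_odd (by grind) (by grind)
      rw [← h, e1] at e
      rw [e1] at hp
      exact absurd hp (not_lt.2 e)
    · have e1 : spiralOrb z k = (z (k + 1), z (k - 1)) := if_pos hk
      have e : (spiralOrb z l).2 ≤ z (k + 1) := by
        rw [spiralOrb]
        split_ifs with hl
        · exact hz.le_of_even (by grind) (by grind)
        · exact hz.le_of_even (by grind) (by omega)
      rw [← h, e1] at e
      rw [e1] at hp
      exact absurd hp (not_lt.2 e)
  intro k hk l hl h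
  rcases lt_trichotomy k l with h' | h' | h'
  · exact absurd h (key k l hk.1 h' hl.2)
  · exact h'
  · exact absurd h.symm (key l k hl.1 h' hk.2)

lemma ncard_orbitals : (orbitals f).ncard = n := by
  rw [hz.orbitals_eq, hz.spiralOrb_injOn.ncard_image, ← Finset.coe_Icc, Set.ncard_coe_finset,
    Nat.card_Icc]
  omega

lemma mem_transitionPoints (k : ℕ) : z k ∈ transitionPoints f := by
  have key : ∀ k ≤ n, z k ∈ transitionPoints f := fun k hk => by
    rcases Nat.eq_zero_or_pos k with rfl | h0
    · refine ⟨_, hz.mem_orbitals le_rfl hz.n_pos, .inr ?_⟩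
      rw [spiralOrb, if_pos odd_one]
    · have h1 := hz.n_pos
      by_cases hn : k + 1 ≤ n
      · refine ⟨_, hz.mem_orbitals (k := k + 1) (by omega) hn, ?_⟩
        rw [spiralOrb]
        split_ifs <;> simp
      · refine ⟨_, hz.mem_orbitals (k := k) h0 hk, ?_⟩
        have : z (k + 1) = z k := by rw [hz.const (k + 1) (by omega), hz.const k (by omega)]
        rw [spiralOrb]
        split_ifs <;> simp [this]
  rcases le_total k n with h | h
  · exact key k h
  · rw [hz.const k h]
    exact key n le_rfl

lemma exists_eq_of_mem_transitionPoints {x : unitInterval} (hx : x ∈ transitionPoints f) :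
    ∃ k, x = z k := by
  obtain ⟨p, hp, h⟩ := hx
  rw [hz.orbitals_eq] at hp
  obtain ⟨k, -, rfl⟩ := hp
  rw [spiralOrb] at h
  split_ifs at h <;> rcases h with rfl | rfl <;> exact ⟨_, rfl⟩

lemma exists_mem_spiralOrb {x : unitInterval} (h1 : z 1 < x) (h0 : x < z 0)
    (hx : ∀ k, x ≠ z k) : ∃ k, x ∈ Ioo (spiralOrb z k).1 (spiralOrb z k).2 := by
  by_contra! h
  have key : ∀ k, (Even k → z (k + 1) < x ∧ x < z k) ∧ (Odd k → z k < x ∧ x < z (k + 1)) := by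
    intro k
    induction k with
    | zero => exact ⟨fun _ => ⟨h1, h0⟩, fun h => by simp at h⟩
    | succ k ih =>
      have h2 := h (k + 1)
      rw [spiralOrb] at h2
      rcases Nat.even_or_odd k with hk | hk
      · obtain ⟨a, b⟩ := ih.1 hk
        rw [if_pos (by grind)] at h2
        refine ⟨fun h => by grind, fun _ => ⟨a, ?_⟩⟩
        by_contra! h3
        exact h2 ⟨lt_of_le_of_ne h3 (hx _).symm, b⟩
      · obtain ⟨a, b⟩ := ih.2 hk
        rw [if_neg (by grind)] at h2
        refine ⟨fun _ => ⟨?_, b⟩, fun h => by grind⟩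
        by_contra! h3
        exact h2 ⟨a, lt_of_le_of_ne h3 (hx _)⟩
  have e : z (n + 1) = z n := hz.const _ (by omega)
  rcases Nat.even_or_odd n with hn | hn
  · have := (key n).1 hn
    rw [e] at this
    exact lt_asymm this.1 this.2
  · have := (key n).2 hn
    rw [e] at this
    exact lt_asymm this.1 this.2

lemma Ioo_subset {k : ℕ} : Ioo (spiralOrb z k).1 (spiralOrb z k).2 ⊆ Ioo (z 1) (z 0) := by
  intro x hx
  rw [spiralOrb] at hx
  split_ifs at hx <;> exact ⟨(hz.one_le' _).trans_lt hx.1, hx.2.trans_le (hz.le_zero _)⟩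

lemma extSupp_eq : extSupp f = Ioo (z 1 : ℝ) (z 0) := by
  apply Subset.antisymm
  · have : (fun t : unitInterval => (t : ℝ)) '' supp f ⊆ Icc (z 1 : ℝ) (z 0) := by
      rintro _ ⟨t, ht, rfl⟩
      obtain ⟨p, hp, htp⟩ := exists_mem_orbital ht
      rw [hz.orbitals_eq] at hp
      obtain ⟨k, -, rfl⟩ := hp
      have := hz.Ioo_subset htp
      exact ⟨this.1.le, this.2.le⟩
    exact (interior_mono (closure_minimal this isClosed_Icc)).trans interior_Icc.subset
  · refine interior_maximal ?_ isOpen_Ioo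
    -- The transition points are finite in number, so that their complement is dense.
    have hfin : ((fun k => (z k : ℝ)) '' Iic n).Finite := (finite_Iic n).image _
    refine ((hfin.countable.dense_compl ℝ).open_subset_closure_inter isOpen_Ioo).trans
      (closure_mono ?_)
    rintro x ⟨hx, hx'⟩
    have hxI : x ∈ Icc (0 : ℝ) 1 := ⟨(z 1).2.1.trans hx.1.le, hx.2.le.trans (z 0).2.2⟩
    obtain ⟨k, hk⟩ := hz.exists_mem_spiralOrb (x := ⟨x, hxI⟩) hx.1 hx.2 fun k hk => hx' <| by
      rcases le_total k n with h | h
      · exact ⟨k, h, (congrArg Subtype.val hk).symm⟩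
      · refine ⟨n, mem_Iic.2 le_rfl, ?_⟩
        rw [hz.const k h] at hk
        exact (congrArg Subtype.val hk).symm
    exact ⟨⟨x, hxI⟩, (hz.mem_orbitals_of_mem hk).2.2.2 _ hk, rfl⟩

end IsSpiral

section Order

variable {f g : MarkedFun} {n m : ℕ} {z y : ℕ → unitInterval}

lemma farLeft_iff (hf : IsSpiral f.toHomeo n z) (hg : IsSpiral g.toHomeo m y) :
    FarLeft f g ↔ z 0 ≤ y 1 := by
  have h1 : (z 1 : ℝ) < z 0 := hf.one_lt_zero
  have h2 : (y 1 : ℝ) < y 0 := hg.one_lt_zero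
  rw [FarLeft, hf.extSupp_eq, hg.extSupp_eq]
  constructor
  · intro h
    by_contra! hlt
    have hlt : (y 1 : ℝ) < z 0 := hlt
    obtain ⟨a, ha1, ha2⟩ := exists_between (max_lt h1 hlt)
    obtain ⟨b, hb1, hb2⟩ := exists_between (lt_min h2 ((le_max_right _ _).trans_lt ha1))
    exact lt_asymm (h a ⟨(le_max_left _ _).trans_lt ha1, ha2⟩ b
      ⟨hb1, hb2.trans_le (min_le_left _ _)⟩) (hb2.trans_le (min_le_right _ _))
  · intro h x hx w hw
    exact hx.2.trans_le (le_trans (show (z 0 : ℝ) ≤ y 1 from h) hw.1.le)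

lemma nested_iff (hf : IsSpiral f.toHomeo n z) (hg : IsSpiral g.toHomeo m y) :
    Nested f g ↔ y 1 < z 1 ∧ z 0 < y 0 := by
  have h1 : (z 1 : ℝ) < z 0 := hf.one_lt_zero
  rw [Nested, hf.extSupp_eq, hg.extSupp_eq, closure_Ioo h1.ne, Icc_subset_Ioo_iff h1.le]
  rfl

end Order

lemma spiralOrb_shift {z z' : ℕ → unitInterval} (h : ∀ k, z' k = z (k + 2)) {k : ℕ} (hk : 1 ≤ k) :
    spiralOrb z' k = spiralOrb z (k + 2) := by
  simp only [spiralOrb, h]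
  by_cases h : Odd k
  · rw [if_pos h, if_pos (by grind), show k - 1 + 2 = k + 2 - 1 by omega]
  · rw [if_neg h, if_neg (by grind), show k - 1 + 2 = k + 2 - 1 by omega]

/-- The outer orbitals are removed by passing to `g°` if there are more than two, which shifts the
spiral by two places. Otherwise the new spiral is that of the left foot of the rightmost orbital. -/
lemma IsReduct.exists_isSpiral {g g' : MarkedFun} {n : ℕ} {z : ℕ → unitInterval}
    (hz : IsSpiral g.toHomeo n z) (h : IsReduct g g') : ∃ n' z', IsSpiral g'.toHomeo n' z' ∧
      ((2 < n ∧ ∀ k, z' k = z (k + 2)) ∨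
        (n ≤ 2 ∧ (∃ h : spiralOrb z 1 ∈ orbitals g.toHomeo, z' 0 = g.marker ⟨_, h⟩) ∧
          ∀ k, 1 ≤ k → z' k = z 2)) := by
  rcases h with ⟨hn, hin, hout, -⟩ | ⟨hn, p, hp, ho, hpos⟩
  · rw [hz.ncard_orbitals] at hn
    have hshift : ∀ k, 1 ≤ k → spiralOrb (fun k => z (k + 2)) k = spiralOrb z (k + 2) :=
      fun k hk => spiralOrb_shift (fun _ => rfl) hk
    have hinner : ∀ t, t ∈ innerSupp g.toHomeo ↔
        ∃ k, 3 ≤ k ∧ k ≤ n ∧ t ∈ Ioo (spiralOrb z k).1 (spiralOrb z k).2 := by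
      have o1 : spiralOrb z 1 = (z 2, z 0) := if_pos odd_one
      have o2 : spiralOrb z 2 = (z 1, z 3) := if_neg (by decide)
      have h13 := hz.lt_of_odd odd_one (by omega)
      intro t
      constructor
      · rintro ⟨p, hp, ⟨q, hq, hqp⟩, ⟨r, hr, hpr⟩, ht⟩
        rw [hz.orbitals_eq] at hp hq hr
        obtain ⟨k, ⟨hk1, hk2⟩, rfl⟩ := hp
        obtain ⟨l, ⟨hl1, hl2⟩, rfl⟩ := hq
        obtain ⟨j, ⟨hj1, hj2⟩, rfl⟩ := hr
        refine ⟨k, ?_, hk2, ht⟩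
        by_contra! hk
        obtain rfl | rfl : k = 1 ∨ k = 2 := by omega
        · -- No orbital starts to the right of the rightmost one.
          have hj := (hz.mem_orbitals hj1 hj2).1
          rw [o1] at hpr
          obtain rfl | hj' : j = 1 ∨ 2 ≤ j := by omega
          · rw [o1] at hpr
            exact lt_irrefl _ hpr
          · have : (spiralOrb z j).1 ≤ z 2 := by
              rw [spiralOrb]
              split_ifs with hodd
              · exact hz.le_of_even even_two (by omega)
              · rcases hj'.eq_or_lt with rfl | hj''
                · exact hz.one_le (by omega)
                · exact hz.le_of_even even_two (by omega)
            exact absurd hpr (not_lt.2 this)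
        · have : z 1 ≤ (spiralOrb z l).1 := by
            rw [spiralOrb]
            split_ifs <;> exact hz.one_le' _
          rw [o2] at hqp
          exact absurd hqp (not_lt.2 this)
      · rintro ⟨k, hk1, hk2, ht⟩
        have hk := hz.mem_orbitals (by omega) hk2
        refine ⟨_, hk, ⟨_, hz.mem_orbitals (k := 2) (by omega) (by omega), ?_⟩,
          ⟨_, hz.mem_orbitals (k := 1) (by omega) (by omega), ?_⟩, ht⟩
        · rw [o2]
          refine h13.trans_le ?_
          rw [spiralOrb]
          split_ifs <;> exact hz.ge_of_odd (by decide) (by grind)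
        · rw [o1]
          refine hk.1.trans_le ?_
          rw [spiralOrb]
          split_ifs <;> exact hz.le_of_even even_two (by omega)
    have hagree : ∀ k, 3 ≤ k → k ≤ n → ∀ t ∈ Ioo (spiralOrb z k).1 (spiralOrb z k).2,
        g'.toHomeo t = g.toHomeo t := fun k h1 h2 t ht => hin t ((hinner t).2 ⟨k, h1, h2, ht⟩)
    have hfix : ∀ t, g.toHomeo t = t → g'.toHomeo t = t := fun t ht => by
      by_cases h : t ∈ innerSupp g.toHomeo
      · rw [hin t h, ht]
      · exact hout t h
    have horb : ∀ k, 3 ≤ k → k ≤ n → spiralOrb z k ∈ orbitals g'.toHomeo := fun k h1 h2 => by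
      have := hz.mem_orbitals (by omega) h2
      refine ⟨this.1, hfix _ this.2.1, hfix _ this.2.2.1, fun t ht => ?_⟩
      rw [hagree k h1 h2 t ht]
      exact this.2.2.2 t ht
    refine ⟨n - 2, fun k => z (k + 2), ⟨by omega, fun k hk => ?_, ?_, fun k h1 h2 h3 => ?_,
      fun k h1 h2 h3 => ?_⟩, .inl ⟨hn, fun _ => rfl⟩⟩
    · rw [hz.const _ (by omega), show n - 2 + 2 = n by omega]
    · ext p
      constructor
      · intro hp
        obtain ⟨t, ht⟩ := exists_between hp.1
        have ht' : t ∈ innerSupp g.toHomeo := by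
          by_contra h
          exact hp.2.2.2 t ht (hout t h)
        obtain ⟨k, hk1, hk2, hk⟩ := (hinner t).1 ht'
        refine ⟨k - 2, ⟨by omega, by omega⟩, ?_⟩
        rw [hshift _ (by omega), show k - 2 + 2 = k by omega]
        exact orbitals_eq_of_mem (horb k hk1 hk2) hp hk ht
      · rintro ⟨k, ⟨hk1, hk2⟩, rfl⟩
        rw [hshift k hk1]
        exact horb _ (by omega) (by omega)
    · rw [hshift k h1]
      refine ⟨horb _ (by omega) (by omega), fun t ht => ?_⟩
      rw [hagree _ (by omega) (by omega) t ht]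
      exact (hz.pos _ (by omega) (by omega) (by grind)).2 t ht
    · rw [hshift k h1]
      refine ⟨horb _ (by omega) (by omega), fun t ht => ?_⟩
      rw [hagree _ (by omega) (by omega) t ht]
      exact (hz.neg _ (by omega) (by omega) (by grind)).2 t ht
  · rw [hz.ncard_orbitals] at hn
    have hp1 : p.1 = spiralOrb z 1 := by
      have h1 : p.1 ∈ spiralOrb z '' Icc 1 n := hz.orbitals_eq ▸ p.2
      obtain ⟨k, ⟨hk1, hk2⟩, hk⟩ := h1
      obtain rfl | rfl : k = 1 ∨ k = 2 := by omega
      · exact hk.symm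
      · have h2 := hz.neg 2 (by omega) hk2 even_two
        rw [hk] at h2
        exact absurd h2 (not_mem_negOrbitals hp)
    obtain ⟨p, hpo⟩ := p
    dsimp only at hp1 hp ho hpos
    subst hp1
    have o1 : spiralOrb z 1 = (z 2, z 0) := if_pos odd_one
    have hz' : spiralOrb (fun k => if k = 0 then g.marker ⟨_, hpo⟩ else z 2) 1 =
        ((spiralOrb z 1).1, g.marker ⟨_, hpo⟩) := by
      rw [spiralOrb, if_pos odd_one]
      simp [o1]
    refine ⟨1, fun k => if k = 0 then g.marker ⟨_, hpo⟩ else z 2, ⟨le_rfl, fun k hk => ?_, ?_,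
      fun k h1 h2 _ => ?_, fun k h1 h2 h3 => ?_⟩, .inr ⟨hn, ⟨hpo, rfl⟩, fun k hk => ?_⟩⟩
    · simp [show k ≠ 0 by omega]
    · rw [ho, Icc_self, image_singleton, hz']
    · obtain rfl : k = 1 := by omega
      rw [hz', hpos]
      rfl
    · obtain rfl : k = 1 := by omega
      simp at h3
    · simp [show k ≠ 0 by omega]

/-! ### The relative position of two spirals -/

/-- The point `x` lies in the orbital number `κ` of the function with the spiral `z`, or in no
orbital if `κ = 0`. -/
def Loc (f : HomeoPlus) (z : ℕ → unitInterval) (κ : ℕ) (x : unitInterval) : Prop :=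
  if κ = 0 then ∀ p ∈ orbitals f, x ∉ Ioo p.1 p.2
  else x ∈ Ioo (spiralOrb z κ).1 (spiralOrb z κ).2

lemma Loc.of_zero {f : HomeoPlus} {z : ℕ → unitInterval} {x : unitInterval} (h : Loc f z 0 x) :
    ∀ p ∈ orbitals f, x ∉ Ioo p.1 p.2 := by
  rwa [Loc, if_pos rfl] at h

lemma Loc.of_pos {f : HomeoPlus} {z : ℕ → unitInterval} {x : unitInterval} {κ : ℕ}
    (h : Loc f z κ x) (hκ : κ ≠ 0) : x ∈ Ioo (spiralOrb z κ).1 (spiralOrb z κ).2 := by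
  rwa [Loc, if_neg hκ] at h

lemma IsSpiral.loc_zero {f : HomeoPlus} {n : ℕ} {z : ℕ → unitInterval} (hz : IsSpiral f n z)
    {x : unitInterval} (hx : x ≤ z 1 ∨ z 0 ≤ x) : Loc f z 0 x := by
  rw [Loc, if_pos rfl, hz.orbitals_eq]
  rintro _ ⟨k, -, rfl⟩ h
  have := hz.Ioo_subset h
  rcases hx with hx | hx
  · exact absurd this.1 (not_lt.2 hx)
  · exact absurd this.2 (not_lt.2 hx)

lemma IsFast.disjoint_feet {f g : MarkedFun} (h : IsFast {f, g}) (hne : f ≠ g)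
    (p : orbitals f.toHomeo) (q : orbitals g.toHomeo) : Disjoint (feet f p) (feet g q) :=
  h.2.2 f (by simp) g (by simp) p q (.inl hne)

lemma IsFast.leftFoot_max_le {f g : MarkedFun} (h : IsFast {f, g}) (hne : f ≠ g)
    (p : orbitals f.toHomeo) (q : orbitals g.toHomeo) :
    min (f.marker p) (g.marker q) ≤ max p.1.1 q.1.1 := by
  by_contra! hlt
  obtain ⟨x, hx⟩ := exists_between hlt
  have h1 := max_lt_iff.1 hx.1
  have h2 := lt_min_iff.1 hx.2
  exact disjoint_left.1 (h.disjoint_feet hne p q) (.inl ⟨h1.1, h2.1⟩) (.inl ⟨h1.2, h2.2⟩)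

/-- The spirals of a standard pair interleave up to some index `N`, from which on both of them stay
inside one orbital of the other function. -/
theorem IsStandardPair.interleave {f g : MarkedFun} (h : IsStandardPair f g) :
    ∀ {n z m y}, IsSpiral f.toHomeo n z → IsSpiral g.toHomeo m y →
      ∃ N, ((N = 0 ∧ FarLeft f g) ∨ (1 ≤ N ∧ Nested f g)) ∧ ∀ k,
        Loc g.toHomeo y (min (k + 1) N) (z k) ∧ Loc f.toHomeo z (min (k - 1) (N - 1)) (y k) := by
  induction h with
  | @farLeft f g hf hg hfast h =>
    intro n z m y hz hy
    have h' := (farLeft_iff hz hy).1 h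
    refine ⟨0, .inl ⟨rfl, h⟩, fun k => ⟨?_, ?_⟩⟩
    · rw [Nat.min_zero]
      exact hy.loc_zero (.inl ((hz.le_zero k).trans h'))
    · rw [Nat.zero_sub, Nat.min_zero]
      exact hz.loc_zero (.inr (h'.trans (hy.one_le' k)))
  | @nested f g g' hf hg hfast hnest hg' hrec ih =>
    intro n z m y hz hy
    obtain ⟨hn1, hn0⟩ := (nested_iff hz hy).1 hnest
    have hne : f ≠ g := by
      rintro rfl
      exact lt_irrefl _ ((nested_iff hz hz).1 hnest).1
    obtain ⟨m', y', hy', hcase⟩ := hg'.exists_isSpiral hy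
    obtain ⟨M, hM, hloc⟩ := ih hy' hz
    have o1 : ∀ z : ℕ → unitInterval, spiralOrb z 1 = (z 2, z 0) := fun z => if_pos odd_one
    have o2 : ∀ z : ℕ → unitInterval, spiralOrb z 2 = (z 1, z 3) := fun z => if_neg (by decide)
    have hf1 := hz.mem_orbitals le_rfl hz.n_pos
    have hg1 := hy.mem_orbitals le_rfl hy.n_pos
    have F0 : y 2 ≤ y' 0 := by
      rcases hcase with ⟨-, h⟩ | ⟨-, ⟨h1, h2⟩, -⟩
      · exact (h 0).ge
      · have := (g.marker_mem ⟨_, h1⟩).1.le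
        rw [h2]
        simpa only [o1] using this
    have F1 : y' 1 = y 3 := by
      rcases hcase with ⟨-, h⟩ | ⟨h1, -, h⟩
      · exact h 1
      · rw [h 1 le_rfl, hy.const 2 h1, hy.const 3 (by omega)]
    -- If `g` has at most two orbitals, then `g'` has a single one, the left foot of the positive
    -- orbital of `g`. By fastness it contains no transition point of `f`.
    have hMcase : (2 < m ∧ ∀ k, y' k = y (k + 2)) ∨ (m ≤ 2 ∧ M ≤ 1 ∧ ∀ k, 1 ≤ k → y' k = y 2) := by
      refine hcase.imp_right fun ⟨h1, ⟨h2, h3⟩, h4⟩ => ⟨h1, ?_, h4⟩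
      by_contra! hM2
      have h5 := (hloc 2).2.of_pos (by omega)
      rw [show min (2 - 1) (M - 1) = 1 by omega, o1, h4 2 (by omega), h3] at h5
      have h6 := hfast.leftFoot_max_le hne ⟨_, hf1⟩ ⟨_, h2⟩
      have h7 := (f.marker_mem ⟨_, hf1⟩).1
      have e1 : (spiralOrb y 1).1 = y 2 := by rw [o1]
      have e2 : (spiralOrb z 1).1 = z 2 := by rw [o1]
      have h8 := (g.marker_mem ⟨_, h2⟩).1
      simp only [e1, e2] at h6 h7 h8
      rw [max_eq_left h5.1.le] at h6
      exact absurd (lt_min h7 h5.2) (not_lt.2 h6)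
    have F2 : ∀ k, Loc f.toHomeo z (min (k + 1) M) (y (k + 2)) := fun k => by
      rcases hMcase with ⟨-, h⟩ | ⟨h1, h2, h⟩
      · rw [← h]
        exact (hloc k).1
      · have := (hloc 1).1
        rw [h 1 le_rfl, show min (1 + 1) M = min (k + 1) M by omega] at this
        rwa [hy.const (k + 2) (by omega), ← hy.const 2 h1]
    have hR : ∀ k, y 2 < z k → Loc g.toHomeo y 1 (z k) := fun k hk => by
      rw [Loc, if_neg one_ne_zero, o1]
      exact ⟨hk, (hz.le_zero k).trans_lt hn0⟩
    have hL : ∀ k, z k < y 3 → Loc g.toHomeo y 2 (z k) := fun k hk => by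
      rw [Loc, if_neg two_ne_zero, o2]
      exact ⟨hn1.trans_le (hz.one_le' k), hk⟩
    refine ⟨M + 1, .inr ⟨by omega, hnest⟩, fun k => ⟨?_, ?_⟩⟩
    · rcases hM with ⟨rfl, hM⟩ | ⟨hM1, hM⟩
      · rw [show min (k + 1) (0 + 1) = 1 by omega]
        refine hR k (lt_of_lt_of_le ?_ (hz.one_le' k))
        refine lt_of_le_of_ne (F0.trans ((farLeft_iff hy' hz).1 hM)) fun he => ?_
        -- Two orbitals of different functions never have the same left endpoint.
        obtain ⟨p, hp, hp1⟩ : ∃ p ∈ orbitals f.toHomeo, p.1 = z 1 := by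
          by_cases h2 : 2 ≤ n
          · exact ⟨_, hz.mem_orbitals (by omega) h2, by rw [o2]⟩
          · have := hz.n_pos
            exact ⟨_, hf1, by rw [o1, hz.const 2 (by omega), hz.const 1 (by omega)]⟩
        have h6 := hfast.leftFoot_max_le hne ⟨p, hp⟩ ⟨_, hg1⟩
        have h7 := (f.marker_mem ⟨p, hp⟩).1
        have h8 := (g.marker_mem ⟨_, hg1⟩).1
        have e1 : (spiralOrb y 1).1 = p.1 := by rw [o1, hp1, he]
        simp only [e1, max_self] at h6 h7 h8
        exact absurd (lt_min h7 h8) (not_lt.2 h6)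
      · obtain ⟨hn1', hn0'⟩ := (nested_iff hy' hz).1 hM
        obtain rfl | rfl | hk : k = 0 ∨ k = 1 ∨ 2 ≤ k := by omega
        · rw [show min (0 + 1) (M + 1) = 1 by omega]
          exact hR 0 (F0.trans_lt hn0')
        · rw [show min (1 + 1) (M + 1) = 2 by omega]
          exact hL 1 (F1 ▸ hn1')
        obtain rfl | hM2 : M = 1 ∨ 2 ≤ M := by omega
        · rw [show min (k + 1) (1 + 1) = 2 by omega]
          have := (hloc 1).1.of_pos (by omega)
          rw [show min (1 + 1) 1 = 1 by omega, o1, F1] at this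
          exact hL k ((hz.le_of_even even_two hk).trans_lt this.1)
        · obtain ⟨-, h⟩ := hMcase.resolve_right (by omega)
          have := (hloc k).2.of_pos (by omega)
          rw [spiralOrb_shift h (by omega),
            show min (k - 1) (M - 1) + 2 = min (k + 1) (M + 1) by omega] at this
          rwa [Loc, if_neg (by omega)]
    · obtain rfl | rfl | ⟨k, rfl⟩ : k = 0 ∨ k = 1 ∨ ∃ l, k = l + 2 := by
        rcases k with _ | _ | k
        exacts [.inl rfl, .inr (.inl rfl), .inr (.inr ⟨k, rfl⟩)]
      · rw [show min (0 - 1) (M + 1 - 1) = 0 by omega]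
        exact hz.loc_zero (.inr hn0.le)
      · rw [show min (1 - 1) (M + 1 - 1) = 0 by omega]
        exact hz.loc_zero (.inl hn1.le)
      · exact F2 k

/-- The relative position of the spirals of a standard pair, in terms of the oscillation. -/
theorem IsStandardPair.loc {f g : MarkedFun} (h : IsStandardPair f g) {n m : ℕ}
    {z y : ℕ → unitInterval} (hz : IsSpiral f.toHomeo n z) (hy : IsSpiral g.toHomeo m y) :
    osc f g ≤ n + 1 ∧ osc f g ≤ m ∧ ∀ k,
      Loc g.toHomeo y (min (k + 1) (osc f g)) (z k) ∧
      Loc f.toHomeo z (min (k - 1) (osc f g - 1)) (y k) := by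
  obtain ⟨N, -, hloc⟩ := h.interleave hz hy
  have hNm : N ≤ m := by
    rcases Nat.eq_zero_or_pos N with rfl | hN
    · omega
    · have := (hloc N).1.of_pos (by omega)
      rw [show min (N + 1) N = N by omega] at this
      exact (hy.valid_of_lt (this.1.trans this.2)).2
  have hNn : N ≤ n + 1 := by
    by_contra! hN
    have h1 := (hloc n).1.of_pos (by omega)
    have h2 := (hloc (n + 1)).1.of_pos (by omega)
    rw [show min (n + 1) N = n + 1 by omega] at h1
    rw [show min (n + 1 + 1) N = n + 2 by omega, hz.const (n + 1) (by omega)] at h2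
    have h3 := orbitals_eq_of_mem (hy.mem_orbitals_of_mem h1) (hy.mem_orbitals_of_mem h2) h1 h2
    have := hy.spiralOrb_injOn (hy.valid_of_lt (h1.1.trans h1.2))
      (hy.valid_of_lt (h2.1.trans h2.2)) h3
    omega
  have hosc : osc f g = N := by
    have : {p | p ∈ orbitals g.toHomeo ∧ ∃ x ∈ transitionPoints f.toHomeo, x ∈ Ioo p.1 p.2} =
        spiralOrb y '' (Finset.Icc 1 N : Set ℕ) := by
      ext p
      constructor
      · rintro ⟨hp, x, hx, hxp⟩
        obtain ⟨k, rfl⟩ := hz.exists_eq_of_mem_transitionPoints hx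
        have hk := (hloc k).1
        by_cases h0 : min (k + 1) N = 0
        · rw [h0] at hk
          exact absurd hxp (hk.of_zero p hp)
        · have hk := hk.of_pos h0
          exact ⟨min (k + 1) N, by simp only [Finset.coe_Icc, mem_Icc]; omega,
            orbitals_eq_of_mem (hy.mem_orbitals_of_mem hk) hp hk hxp⟩
      · rintro ⟨j, hj, rfl⟩
        simp only [Finset.coe_Icc, mem_Icc] at hj
        have := (hloc (j - 1)).1.of_pos (by omega)
        rw [show min (j - 1 + 1) N = j by omega] at this
        exact ⟨hy.mem_orbitals_of_mem this, _, hz.mem_transitionPoints _, this⟩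
    rw [osc, this, InjOn.ncard_image, Set.ncard_coe_finset, Nat.card_Icc]
    · omega
    · rw [Finset.coe_Icc]
      exact hy.spiralOrb_injOn.mono (Icc_subset_Icc_right hNm)
  rw [hosc]
  exact ⟨hNn, hNm, hloc⟩

/-! ### The dynamics of a single bump -/

section Bump

variable (f : MarkedFun) (p : orbitals f.toHomeo)

open Classical in
/-- The homeomorphism among `f` and its inverse that is positive on the orbital `p`. -/
noncomputable def bumpUp : HomeoPlus :=
  if p.1 ∈ posOrbitals f.toHomeo then f.toHomeo else f.toHomeo⁻¹

/-- The feet of a bump, with the left endpoint adjoined to the left foot, so that both of them are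
half-open; `true` stands for the right foot. -/
noncomputable def halfFoot (b : Bool) : Set unitInterval :=
  bif b then Ico (bumpUp f p (f.marker p)) p.1.2 else Ico p.1.1 (f.marker p)

lemma rightFoot_eq : rightFoot f p = Ico (bumpUp f p (f.marker p)) p.1.2 := by
  rw [rightFoot, bumpUp]
  split_ifs <;> rfl

lemma inv_apply_of_fix {g : HomeoPlus} {x : unitInterval} (h : g x = x) : g⁻¹ x = x := by
  conv_lhs => rw [← h]
  exact RelIso.inv_apply_self _ _

lemma bumpUp_fst : bumpUp f p p.1.1 = p.1.1 := by
  rw [bumpUp]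
  split_ifs
  exacts [p.2.2.1, inv_apply_of_fix p.2.2.1]

lemma bumpUp_snd : bumpUp f p p.1.2 = p.1.2 := by
  rw [bumpUp]
  split_ifs
  exacts [p.2.2.2.1, inv_apply_of_fix p.2.2.2.1]

lemma marker_lt_bumpUp : f.marker p < bumpUp f p (f.marker p) := by
  rw [bumpUp]
  split_ifs with h
  · exact h.2 _ (f.marker_mem p)
  · have hneg := (mem_posOrbitals_or_negOrbitals p.2).resolve_left h
    refine f.toHomeo.lt_iff_lt.1 ?_
    rw [RelIso.apply_inv_self]
    exact hneg.2 _ (f.marker_mem p)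

lemma bumpUp_marker_lt : bumpUp f p (f.marker p) < p.1.2 := by
  conv_rhs => rw [← bumpUp_snd f p]
  exact (bumpUp f p).strictMono (f.marker_mem p).2

lemma halfFoot_subset (b : Bool) : halfFoot f p b ⊆ Ico p.1.1 p.1.2 := by
  cases b
  · exact Ico_subset_Ico_right (f.marker_mem p).2.le
  · exact Ico_subset_Ico_left ((f.marker_mem p).1.trans (marker_lt_bumpUp f p)).le

lemma halfFoot_push {b : Bool} {x : unitInterval} (hx : x ∈ Ico p.1.1 p.1.2)
    (hx' : x ∉ halfFoot f p (!b)) :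
    (bif b then bumpUp f p else (bumpUp f p)⁻¹) x ∈ halfFoot f p b := by
  cases b
  · have h : x < bumpUp f p (f.marker p) := not_le.1 fun h => hx' ⟨h, hx.2⟩
    refine ⟨?_, ?_⟩ <;> simp only [cond_false]
    · rw [← (bumpUp f p).le_iff_le, RelIso.apply_inv_self, bumpUp_fst]
      exact hx.1
    · rwa [← (bumpUp f p).lt_iff_lt, RelIso.apply_inv_self]
  · have h : f.marker p ≤ x := not_lt.1 fun h => hx' ⟨hx.1, h⟩
    refine ⟨(bumpUp f p).le_iff_le.2 h, ?_⟩
    have := (bumpUp f p).lt_iff_lt.2 hx.2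
    rwa [bumpUp_snd] at this

lemma halfFoot_pull {b : Bool} {x : unitInterval} (hx : x ∈ halfFoot f p b) :
    (bif b then bumpUp f p else (bumpUp f p)⁻¹)⁻¹ x ∈ Ico p.1.1 p.1.2 ∧
      (bif b then bumpUp f p else (bumpUp f p)⁻¹)⁻¹ x ∉ halfFoot f p (!b) := by
  have hm := f.marker_mem p
  cases b
  · simp only [cond_false, inv_inv, Bool.not_false]
    have h1 : bumpUp f p x < bumpUp f p (f.marker p) := (bumpUp f p).lt_iff_lt.2 hx.2
    have h2 : bumpUp f p p.1.1 ≤ bumpUp f p x := (bumpUp f p).le_iff_le.2 hx.1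
    rw [bumpUp_fst] at h2
    exact ⟨⟨h2, h1.trans (bumpUp_marker_lt f p)⟩, fun h => absurd h1 (not_lt.2 h.1)⟩
  · simp only [cond_true, Bool.not_true]
    have h1 : f.marker p ≤ (bumpUp f p)⁻¹ x := by
      rw [← (bumpUp f p).le_iff_le, RelIso.apply_inv_self]
      exact hx.1
    refine ⟨⟨hm.1.le.trans h1, ?_⟩, fun h => absurd h1 (not_le.2 h.2)⟩
    rw [← (bumpUp f p).lt_iff_lt, RelIso.apply_inv_self, bumpUp_snd]
    exact hx.2

lemma halfFoot_side {b c : Bool} {x : unitInterval} (hb : x ∈ halfFoot f p b)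
    (hc : x ∈ halfFoot f p c) : b = c := by
  have := marker_lt_bumpUp f p
  cases b <;> cases c <;> first | rfl | skip
  · exact absurd (hb.2.trans (this.trans_le hc.1)) (lt_irrefl _)
  · exact absurd (hc.2.trans (this.trans_le hb.1)) (lt_irrefl _)

end Bump

/-! ### The relative position of feet -/

section Fast

variable {f g : MarkedFun}

/-- Disjointness of the feet of two bumps of different functions, in terms of their endpoints. -/
lemma IsFast.ineqs (h : IsFast {f, g}) (hne : f ≠ g) (p : orbitals f.toHomeo)
    (q : orbitals g.toHomeo) :
    (f.marker p ≤ q.1.1 ∨ g.marker q ≤ p.1.1) ∧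
    (f.marker p ≤ bumpUp g q (g.marker q) ∨ q.1.2 ≤ p.1.1) ∧
    (g.marker q ≤ bumpUp f p (f.marker p) ∨ p.1.2 ≤ q.1.1) ∧
    (p.1.2 ≤ bumpUp g q (g.marker q) ∨ q.1.2 ≤ bumpUp f p (f.marker p)) := by
  have hd := disjoint_left.1 (h.disjoint_feet hne p q)
  have a1 := (f.marker_mem p).1
  have a2 := bumpUp_marker_lt f p
  have b1 := (g.marker_mem q).1
  have b2 := bumpUp_marker_lt g q
  have LL : ∀ x, x ∈ Ioo p.1.1 (f.marker p) → x ∉ Ioo q.1.1 (g.marker q) :=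
    fun x h1 h2 => hd (.inl h1) (.inl h2)
  have LR : ∀ x, x ∈ Ioo p.1.1 (f.marker p) → x ∉ Ico (bumpUp g q (g.marker q)) q.1.2 :=
    fun x h1 h2 => hd (.inl h1) (.inr (by rwa [rightFoot_eq]))
  have RL : ∀ x, x ∈ Ico (bumpUp f p (f.marker p)) p.1.2 → x ∉ Ioo q.1.1 (g.marker q) :=
    fun x h1 h2 => hd (.inr (by rwa [rightFoot_eq])) (.inl h2)
  have RR : ∀ x, x ∈ Ico (bumpUp f p (f.marker p)) p.1.2 →
      x ∉ Ico (bumpUp g q (g.marker q)) q.1.2 :=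
    fun x h1 h2 => hd (.inr (by rwa [rightFoot_eq])) (.inr (by rwa [rightFoot_eq]))
  refine ⟨?_, ?_, ?_, ?_⟩ <;> by_contra! hc
  · obtain ⟨x, h1, h2⟩ := exists_between (max_lt (lt_min a1 hc.2) (lt_min hc.1 b1))
    rw [max_lt_iff] at h1
    rw [lt_min_iff] at h2
    exact LL x ⟨h1.1, h2.1⟩ ⟨h1.2, h2.2⟩
  · obtain ⟨x, h1, h2⟩ := exists_between (max_lt (lt_min a1 hc.2) (lt_min hc.1 b2))
    rw [max_lt_iff] at h1
    rw [lt_min_iff] at h2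
    exact LR x ⟨h1.1, h2.1⟩ ⟨h1.2.le, h2.2⟩
  · obtain ⟨x, h1, h2⟩ := exists_between (max_lt (lt_min a2 hc.1) (lt_min hc.2 b1))
    rw [max_lt_iff] at h1
    rw [lt_min_iff] at h2
    exact RL x ⟨h1.1.le, h2.1⟩ ⟨h1.2, h2.2⟩
  · obtain ⟨x, h1, h2⟩ := exists_between (max_lt (lt_min a2 hc.2) (lt_min hc.1 b2))
    rw [max_lt_iff] at h1
    rw [lt_min_iff] at h2
    exact RR x ⟨h1.1.le, h2.1⟩ ⟨h1.2.le, h2.2⟩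

lemma IsFast.symm (h : IsFast {f, g}) : IsFast {g, f} := by rwa [pair_comm]

lemma IsFast.halfFoot_disj (h : IsFast {f, g}) (hne : f ≠ g) (p : orbitals f.toHomeo)
    (q : orbitals g.toHomeo) {b c : Bool} {x : unitInterval} (hb : x ∈ halfFoot f p b) :
    x ∉ halfFoot g q c := by
  intro hc
  obtain ⟨h1, h2, h3, h4⟩ := h.ineqs hne p q
  cases b <;> cases c <;> simp only [halfFoot, cond_true, cond_false, mem_Ico] at hb hc
  · rcases h1 with h | h
    · exact absurd (hb.2.trans_le h) (not_lt.2 hc.1)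
    · exact absurd (hc.2.trans_le h) (not_lt.2 hb.1)
  · rcases h2 with h | h
    · exact absurd (hb.2.trans_le h) (not_lt.2 hc.1)
    · exact absurd (hc.2.trans_le h) (not_lt.2 hb.1)
  · rcases h3 with h | h
    · exact absurd (hc.2.trans_le h) (not_lt.2 hb.1)
    · exact absurd (hb.2.trans_le h) (not_lt.2 hc.1)
  · rcases h4 with h | h
    · exact absurd (hb.2.trans_le h) (not_lt.2 hc.1)
    · exact absurd (hc.2.trans_le h) (not_lt.2 hb.1)

/-- Whether a foot lies in an orbital of another function is decided by the transition point to
which it is attached. -/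
lemma IsFast.halfFoot_loc (h : IsFast {f, g}) (hne : f ≠ g) (p : orbitals f.toHomeo)
    (q : orbitals g.toHomeo) {b : Bool} {x : unitInterval} (hx : x ∈ halfFoot f p b) :
    x ∈ Ico q.1.1 q.1.2 ↔ (bif b then p.1.2 else p.1.1) ∈ Ioo q.1.1 q.1.2 := by
  obtain ⟨h1, h2, h3, h4⟩ := h.ineqs hne p q
  have a1 := (f.marker_mem p).1
  have a2 := bumpUp_marker_lt f p
  have b1 := (g.marker_mem q).1
  have b2 := bumpUp_marker_lt g q
  cases b <;> simp only [halfFoot, cond_true, cond_false, mem_Ico, mem_Ioo] at hx ⊢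
  · constructor
    · rintro ⟨k1, k2⟩
      refine ⟨?_, hx.1.trans_lt k2⟩
      rcases h1 with h | h
      · exact absurd (hx.2.trans_le h) (not_lt.2 k1)
      · exact b1.trans_le h
    · rintro ⟨k1, k2⟩
      refine ⟨k1.le.trans hx.1, ?_⟩
      rcases h2 with h | h
      · exact hx.2.trans_le (h.trans b2.le)
      · exact absurd k2 (not_lt.2 h)
  · constructor
    · rintro ⟨k1, k2⟩
      refine ⟨k1.trans_lt hx.2, ?_⟩
      rcases h4 with h | h
      · exact h.trans_lt b2
      · exact absurd (k2.trans_le h) (not_lt.2 hx.1)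
    · rintro ⟨k1, k2⟩
      refine ⟨?_, hx.2.trans k2⟩
      rcases h3 with h | h
      · exact (b1.le.trans h).trans hx.1
      · exact absurd k1 (not_lt.2 h)

lemma IsStandardPair.isFast (h : IsStandardPair f g) : IsFast {f, g} := by
  cases h <;> assumption

end Fast

/-! ### The ping-pong system of a standard generating set -/

lemma eventually_mem_Ico_iff (a b x : unitInterval) : ∀ᶠ y in 𝓝[>] x, y ∈ Ico a b ↔ x ∈ Ico a b := by
  have key : ∀ c : unitInterval, ∀ᶠ y in 𝓝[>] x, c ≤ y ↔ c ≤ x := fun c => by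
    rcases le_or_gt c x with h | h
    · filter_upwards [self_mem_nhdsWithin] with y hy
      exact ⟨fun _ => h, fun _ => h.trans (le_of_lt hy)⟩
    · filter_upwards [mem_nhdsWithin_of_mem_nhds (Iio_mem_nhds h)] with y hy
      exact ⟨fun h' => absurd hy (not_lt.2 h'), fun h' => absurd h (not_lt.2 h')⟩
  filter_upwards [key a, key b] with y h1 h2
  rw [mem_Ico, mem_Ico, h1, ← not_le, h2, not_le]

section System

open Classical in
/-- The combinatorics of a family of standard functions with order relation `r` and oscillation
numbers `o`: the number of the orbital of the `j`-th function in which a foot lies. The foot is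
attached to the point with index `num - 1` (outer foot) or `num + 1` (inner foot) of the spiral. -/
noncomputable def footLoc (r : ι → ι → Prop) (o : ι → ι → ℕ) (j : ι) (φ : Foot ι) : ℕ :=
  if j = φ.idx then φ.num
  else if r φ.idx j then min ((if φ.out then φ.num - 1 else φ.num + 1) + 1) (o φ.idx j)
  else min ((if φ.out then φ.num - 1 else φ.num + 1) - 1) (o j φ.idx - 1)

/-- The odd orbitals of a standard function are on the right, the even ones on the left. So the
foot with label `φ` is the right one if its orbital is odd and the foot is an outer one, or if its
orbital is even and the foot is an inner one. -/
def Foot.side (φ : Foot ι) : Bool := decide (Odd φ.num) == φ.out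

lemma Foot.side_opp (φ : Foot ι) : φ.opp.side = !φ.side := by
  simp only [side, opp]
  cases φ.out <;> by_cases h : Odd φ.num <;> simp [h]

variable {g : ι → MarkedFun} {n : ι → ℕ} {z : ι → ℕ → unitInterval}
  {r : ι → ι → Prop} {o : ι → ι → ℕ}

/-- The half-open foot with a given label. -/
def footSet (g : ι → MarkedFun) (z : ι → ℕ → unitInterval) (φ : Foot ι) : Set unitInterval :=
  {x | ∃ h : spiralOrb (z φ.idx) φ.num ∈ orbitals (g φ.idx).toHomeo,
    x ∈ halfFoot (g φ.idx) ⟨_, h⟩ φ.side}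

lemma Foot.act_eq (hz : ∀ i, IsSpiral (g i).toHomeo (n i) (z i)) (φ : Foot ι)
    (h : spiralOrb (z φ.idx) φ.num ∈ orbitals (g φ.idx).toHomeo) :
    φ.act (fun i => (g i).toHomeo) =
      bif φ.side then bumpUp (g φ.idx) ⟨_, h⟩ else (bumpUp (g φ.idx) ⟨_, h⟩)⁻¹ := by
  obtain ⟨h1, h2⟩ := (hz φ.idx).valid_of_lt h.1
  simp only [act, letterAct, bumpUp, side]
  by_cases hk : Odd φ.num
  · rw [if_pos ((hz φ.idx).pos _ h1 h2 hk)]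
    cases φ.out <;> simp [hk]
  · rw [if_neg fun h => not_mem_negOrbitals h
      ((hz φ.idx).neg _ h1 h2 (Nat.not_odd_iff_even.1 hk))]
    cases φ.out <;> simp [hk]

lemma spiralOrb_side (z : ℕ → unitInterval) (φ : Foot ι) :
    (bif φ.side then (spiralOrb z φ.num).2 else (spiralOrb z φ.num).1) =
      z (if φ.out then φ.num - 1 else φ.num + 1) := by
  simp only [Foot.side, spiralOrb]
  by_cases hk : Odd φ.num <;> cases φ.out <;> simp [hk]

/-- A finite family of standard functions, any two of which form a standard pair, is a ping-pong
system whose combinatorics is determined by the order and the oscillation numbers. -/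
theorem exists_pingPong (hg : Function.Injective g) (hs : ∀ i, IsStandard (g i))
    (hr : ∀ i j, i ≠ j → (r i j ∧ IsStandardPair (g i) (g j)) ∨
      (¬ r i j ∧ r j i ∧ IsStandardPair (g j) (g i)))
    (ho : ∀ i j, r i j → o i j = osc (g i) (g j)) :
    Nonempty (PingPong (fun i => (g i).toHomeo) (footLoc r o)) := by
  choose n z hz using fun i => (hs i).exists_isSpiral
  have hfast : ∀ {i j}, i ≠ j → IsFast {g i, g j} := fun {i j} hij => by
    rcases hr i j hij with ⟨-, h⟩ | ⟨-, -, h⟩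
    exacts [h.isFast, h.isFast.symm]
  have horb : ∀ {i k x}, x ∈ Ico (spiralOrb (z i) k).1 (spiralOrb (z i) k).2 →
      spiralOrb (z i) k ∈ orbitals (g i).toHomeo := fun {i k x} hx => by
    obtain ⟨h1, h2⟩ := (hz i).valid_of_lt (hx.1.trans_lt hx.2)
    exact (hz i).mem_orbitals h1 h2
  have horb_disj : ∀ {i k k' x}, x ∈ Ico (spiralOrb (z i) k).1 (spiralOrb (z i) k).2 →
      x ∈ Ico (spiralOrb (z i) k').1 (spiralOrb (z i) k').2 → k = k' := by
    intro i k k' x hx hx'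
    obtain ⟨t, ht, ht'⟩ := exists_between (lt_min hx.2 hx'.2)
    rw [lt_min_iff] at ht'
    have := orbitals_eq_of_mem (horb hx) (horb hx') ⟨hx.1.trans_lt ht, ht'.1⟩
      ⟨hx'.1.trans_lt ht, ht'.2⟩
    exact (hz i).spiralOrb_injOn ((hz i).valid_of_lt (horb hx).1)
      ((hz i).valid_of_lt (horb hx').1) this
  have hsub : ∀ {φ x}, x ∈ footSet g z φ →
      x ∈ Ico (spiralOrb (z φ.idx) φ.num).1 (spiralOrb (z φ.idx) φ.num).2 := by
    rintro φ x ⟨h, hx⟩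
    exact halfFoot_subset _ _ _ hx
  have hdisj : ∀ {φ ψ x}, x ∈ footSet g z φ → x ∈ footSet g z ψ → φ = ψ := by
    intro φ ψ x hφ hψ
    by_cases hi : φ.idx = ψ.idx
    · have h1 := hsub hφ
      have h2 := hsub hψ
      obtain ⟨i, k, e⟩ := φ
      obtain ⟨j, l, e'⟩ := ψ
      obtain rfl : i = j := hi
      obtain rfl : k = l := horb_disj h1 h2
      obtain ⟨h, hx⟩ := hφ
      obtain ⟨h', hx'⟩ := hψ
      have := halfFoot_side _ _ hx hx'
      simp only [Foot.side] at this
      have : e = e' := by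
        revert this
        cases decide (Odd k) <;> cases e <;> cases e' <;> simp
      rw [this]
    · obtain ⟨h, hx⟩ := hφ
      obtain ⟨h', hx'⟩ := hψ
      exact absurd hx' ((hfast hi).halfFoot_disj (fun h => hi (hg h)) _ _ hx)
  -- The orbitals of the other functions are located by the transition points of the spiral.
  have hloc : ∀ (φ : Foot ι) j, j ≠ φ.idx → Loc (g j).toHomeo (z j) (footLoc r o j φ)
      (z φ.idx (if φ.out then φ.num - 1 else φ.num + 1)) := by
    intro φ j hj
    rw [footLoc, if_neg hj]
    rcases hr φ.idx j hj.symm with ⟨h1, h2⟩ | ⟨h1, h2, h3⟩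
    · rw [if_pos h1, ho _ _ h1]
      exact ((h2.loc (hz _) (hz _)).2.2 _).1
    · rw [if_neg h1, ho _ _ h2]
      exact ((h3.loc (hz _) (hz _)).2.2 _).2
  have hiff : ∀ {φ : Foot ι} {j k x}, j ≠ φ.idx → x ∈ footSet g z φ →
      spiralOrb (z j) k ∈ orbitals (g j).toHomeo →
      (x ∈ Ico (spiralOrb (z j) k).1 (spiralOrb (z j) k).2 ↔
        z φ.idx (if φ.out then φ.num - 1 else φ.num + 1) ∈
          Ioo (spiralOrb (z j) k).1 (spiralOrb (z j) k).2) := by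
    rintro φ j k x hj ⟨h, hx⟩ hk
    rw [← spiralOrb_side (z φ.idx) φ]
    exact (hfast hj.symm).halfFoot_loc (fun h => hj (hg h).symm) ⟨_, h⟩ ⟨_, hk⟩ hx
  refine ⟨{
    n := n
    n_pos := fun i => (hz i).n_pos
    orb := fun i k => Ico (spiralOrb (z i) k).1 (spiralOrb (z i) k).2
    foot := footSet g z
    D_self := fun φ => if_pos rfl
    orb_valid := fun {i k x} hx => (hz i).valid_of_lt (hx.1.trans_lt hx.2)
    foot_sub := hsub
    push_mem := ?_
    pull_mem := ?_
    fix := ?_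
    orb_disj := horb_disj
    loc_zero := ?_
    loc_pos := ?_
    foot_disj := hdisj
    orb_right := fun i k x => eventually_mem_Ico_iff _ _ _
    foot_right := ?_
    sep := ?_
    D_le := ?_
    sat := ?_ }⟩
  · intro φ x hx hx'
    have h := horb hx
    refine ⟨h, ?_⟩
    rw [Foot.act_eq hz φ h]
    refine halfFoot_push _ _ hx fun h' => hx' ⟨h, ?_⟩
    rw [Foot.side_opp]
    exact h'
  · rintro φ x ⟨h, hx⟩
    rw [Foot.act_eq hz φ h]
    obtain ⟨h1, h2⟩ := halfFoot_pull _ _ hx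
    refine ⟨h1, fun ⟨h3, h4⟩ => h2 ?_⟩
    rw [Foot.side_opp] at h4
    exact h4
  · intro i x hx
    by_contra hne
    obtain ⟨p, hp, hxp⟩ := exists_mem_orbital hne
    rw [(hz i).orbitals_eq] at hp
    obtain ⟨k, -, rfl⟩ := hp
    exact hx k ⟨hxp.1.le, hxp.2⟩
  · intro φ x j hx h0 k hk
    by_cases hj : j = φ.idx
    · rw [footLoc, if_pos hj] at h0
      have := ((hz _).valid_of_lt ((hsub hx).1.trans_lt (hsub hx).2)).1
      omega
    · have := hloc φ j hj
      rw [h0] at this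
      exact this.of_zero _ (horb hk) ((hiff hj hx (horb hk)).1 hk)
  · intro φ x j hx h0
    by_cases hj : j = φ.idx
    · subst hj
      rw [footLoc, if_pos rfl]
      exact hsub hx
    · have := (hloc φ j hj).of_pos h0
      exact (hiff hj hx ((hz j).mem_orbitals_of_mem this)).2 this
  · intro φ x
    by_cases h : spiralOrb (z φ.idx) φ.num ∈ orbitals (g φ.idx).toHomeo
    · have : footSet g z φ = halfFoot (g φ.idx) ⟨_, h⟩ φ.side :=
        Set.ext fun x => ⟨fun ⟨_, hx⟩ => hx, fun hx => ⟨h, hx⟩⟩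
      rw [this, halfFoot]
      cases φ.side <;> exact eventually_mem_Ico_iff _ _ _
    · exact .of_forall fun y => ⟨fun hy => absurd hy.1 h, fun hy => absurd hy.1 h⟩
  · intro φ h1 h2
    have h := (hz φ.idx).mem_orbitals h1 h2
    set p : orbitals (g φ.idx).toHomeo := ⟨_, h⟩ with hp
    have a1 := (g φ.idx).marker_mem p
    have a2 := marker_lt_bumpUp _ p
    have a3 := bumpUp_marker_lt _ p
    -- The marker is outside both feet. The second point is the one where the foot begins.
    have hs : ∀ b, (g φ.idx).marker p ∉ halfFoot (g φ.idx) p b := by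
      rintro (_ | _) hb
      · exact lt_irrefl _ hb.2
      · exact absurd a2 (not_lt.2 hb.1)
    obtain ⟨y, hy⟩ : (halfFoot (g φ.idx) p φ.side).Nonempty := by
      cases φ.side
      · exact ⟨_, le_rfl, a1.1⟩
      · exact ⟨_, le_rfl, a3⟩
    have hy' : y ∈ footSet g z φ := ⟨h, hy⟩
    refine ⟨(g φ.idx).marker p, y, ⟨a1.1.le, a1.2⟩, fun h' => hs _ h'.2, hsub hy', fun h' => ?_,
      fun ψ h3 h4 => ?_⟩
    · have h5 := congrArg Foot.out (hdisj hy' h')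
      simp [Foot.opp] at h5
    · obtain rfl := hdisj hy' h4
      exact hs _ h3.2
  · intro φ j h1 h2
    by_cases hj : j = φ.idx
    · rw [footLoc, if_pos hj, hj]
      exact h2
    · rw [footLoc, if_neg hj]
      rcases hr φ.idx j (Ne.symm hj) with ⟨h3, h4⟩ | ⟨h3, h4, h5⟩
      · rw [if_pos h3, ho _ _ h3]
        have := (h4.loc (hz _) (hz _)).2.1
        omega
      · rw [if_neg h3, ho _ _ h4]
        have := (h5.loc (hz _) (hz _)).1
        omega
  · intro i j k e hj hk
    rw [footLoc, footLoc, if_neg hj, if_neg hj]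
    simp only
    rcases hr i j (Ne.symm hj) with ⟨h3, h4⟩ | ⟨h3, h4, h5⟩
    · rw [if_pos h3, if_pos h3, ho _ _ h3]
      have := (h4.loc (hz _) (hz _)).1
      cases e <;> simp <;> omega
    · rw [if_neg h3, if_neg h3, ho _ _ h4]
      have := (h5.loc (hz _) (hz _)).2.1
      cases e <;> simp <;> omega

end System

/-! ### The order of a standard generating set, and the isomorphism -/

lemma IsStandardPair.precedes {f g : MarkedFun} (h : IsStandardPair f g) : Precedes f g := by
  cases h with
  | farLeft _ _ _ h => exact .inl h
  | nested _ _ _ h _ _ => exact .inr h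

lemma Precedes.lt {f g : MarkedFun} {n m : ℕ} {z y : ℕ → unitInterval} (h : Precedes f g)
    (hz : IsSpiral f.toHomeo n z) (hy : IsSpiral g.toHomeo m y) : z 0 < y 0 := by
  rcases h with h | h
  · exact ((farLeft_iff hz hy).1 h).trans_lt hy.one_lt_zero
  · exact ((nested_iff hz hy).1 h).2

section Order

variable {A : Set MarkedFun} (hA : IsStandardGenSet A)
include hA

/-- The order of a standard generating set is that of the right ends of the extended supports. -/
lemma IsStandardGenSet.exists_rightEnd :
    ∃ e : A → unitInterval, ∀ f g : A, Precedes f.1 g.1 → e f < e g := by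
  choose n z hz using fun f : A => (hA.standard f.1 f.2).exists_isSpiral
  exact ⟨fun f => z f 0, fun f g h => h.lt (hz f) (hz g)⟩

lemma IsStandardGenSet.isWellOrder : IsWellOrder A fun f g => Precedes f.1 g.1 := by
  obtain ⟨e, he⟩ := hA.exists_rightEnd
  have := hA.finite.to_subtype
  refine { wf := ?_, trichotomous := fun f g h1 h2 => ?_ }
  · have : IsTrans A (InvImage (· < ·) e) := ⟨fun _ _ _ h1 h2 => lt_trans h1 h2⟩
    have : Std.Irrefl (InvImage (α := A) (· < ·) e) := ⟨fun _ h => lt_irrefl _ h⟩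
    exact Subrelation.wf (fun {f g} h => he f g h)
      (Finite.wellFounded_of_trans_of_irrefl (InvImage (· < ·) e))
  · by_contra hne
    rcases hA.pairwise f.2 g.2 (fun h => hne (Subtype.ext h)) with h | h
    exacts [h1 h.precedes, h2 h.precedes]

lemma IsStandardGenSet.pair_cases (f g : A) (hne : f ≠ g) :
    (Precedes f.1 g.1 ∧ IsStandardPair f.1 g.1) ∨
      (¬ Precedes f.1 g.1 ∧ Precedes g.1 f.1 ∧ IsStandardPair g.1 f.1) := by
  obtain ⟨e, he⟩ := hA.exists_rightEnd
  rcases hA.pairwise f.2 g.2 (fun h => hne (Subtype.ext h)) with h | h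
  · exact .inl ⟨h.precedes, h⟩
  · exact .inr ⟨fun h' => lt_asymm (he _ _ h') (he _ _ h.precedes), h.precedes, h⟩

end Order

lemma OrderPreserving.eq {A B : Set MarkedFun} (hB : IsStandardGenSet B) {θ θ' : A ≃ B}
    (h : OrderPreserving θ) (h' : OrderPreserving θ') : θ = θ' := by
  have := hB.isWellOrder
  let e : (fun f g : A => Precedes f.1 g.1) ≃r (fun f g : B => Precedes f.1 g.1) :=
    ⟨θ, fun {f g} => (h f g).symm⟩
  let e' : (fun f g : A => Precedes f.1 g.1) ≃r (fun f g : B => Precedes f.1 g.1) :=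
    ⟨θ', fun {f g} => (h' f g).symm⟩
  ext1 f
  exact e.toInitialSeg.eq e'.toInitialSeg f

lemma lift_mk_eq_wordAct {ι : Type*} (f : ι → HomeoPlus) (L : List (ι × Bool)) :
    FreeGroup.lift f (FreeGroup.mk L) = wordAct f L := FreeGroup.lift_mk

/-- Two families that satisfy the same relations generate isomorphic groups. -/
lemma exists_mulEquiv_of_ker_eq {F G : Type*} [Group F] [Group G] {p q : F →* G} {H K : Subgroup G}
    (hpq : p.ker = q.ker) (hH : p.range = H) (hK : q.range = K) :
    ∃ e : H ≃* K, ∀ (x : F) (h : p x ∈ H), (e ⟨p x, h⟩ : G) = q x := by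
  subst hH hK
  let e₁ := QuotientGroup.quotientKerEquivRange p
  let e₂ := QuotientGroup.quotientKerEquivRange q
  refine ⟨(e₁.symm.trans (QuotientGroup.quotientMulEquivOfEq hpq)).trans e₂, fun x h => ?_⟩
  have : e₁.symm ⟨p x, h⟩ = (x : F ⧸ p.ker) := by
    rw [MulEquiv.symm_apply_eq]
    rfl
  simp only [MulEquiv.trans_apply, this]
  rfl

lemma range_lift_eq_gen {ι : Type*} {A : Set MarkedFun} (e : ι ≃ A) :
    (FreeGroup.lift fun i => (e i).1.toHomeo).range = gen A := by
  rw [FreeGroup.range_lift_eq_closure, gen]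
  congr 1
  ext f
  constructor
  · rintro ⟨i, rfl⟩
    exact ⟨_, (e i).2, rfl⟩
  · rintro ⟨g, hg, rfl⟩
    exact ⟨e.symm ⟨g, hg⟩, by simp⟩

end StdGen

theorem mainTheorem3 (A B : Set StdGen.MarkedFun)
    (hA : StdGen.IsStandardGenSet A) (hB : StdGen.IsStandardGenSet B)
    (hAB : StdGen.SameSignature A B) :
    (∃! θ : A ≃ B, StdGen.OrderPreserving θ) ∧
      ∀ θ : A ≃ B, StdGen.OrderPreserving θ →
        ∃ Φ : StdGen.gen A ≃* StdGen.gen B, ∀ f : A, Φ (StdGen.toGen f) = StdGen.toGen (θ f) := by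
  obtain ⟨θ, hθ, hosc⟩ := hAB
  refine ⟨⟨θ, hθ, fun θ' hθ' => hθ'.eq hB hθ⟩, fun θ' hθ' => ?_⟩
  obtain rfl := hθ'.eq hB hθ
  have := hA.finite.to_subtype
  obtain ⟨P⟩ := StdGen.exists_pingPong (g := fun f : A => f.1)
    (r := fun f g => StdGen.Precedes f.1 g.1) (o := fun f g => StdGen.osc f.1 g.1) Subtype.val_injective (fun f => hA.standard _ f.2)
    hA.pair_cases (fun _ _ _ => rfl)
  obtain ⟨Q⟩ := StdGen.exists_pingPong (g := fun f : A => (θ' f).1)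
    (r := fun f g => StdGen.Precedes f.1 g.1) (o := fun f g => StdGen.osc f.1 g.1)
    (Subtype.val_injective.comp θ'.injective) (fun f => hB.standard _ (θ' f).2)
    (fun f g hne => by
      rw [hθ f g, hθ g f]
      exact hB.pair_cases (θ' f) (θ' g) (fun h => hne (θ'.injective h)))
    hosc
  have hker : (FreeGroup.lift fun f : A => f.1.toHomeo).ker =
      (FreeGroup.lift fun f : A => (θ' f).1.toHomeo).ker := by
    ext w
    obtain ⟨L, rfl⟩ : ∃ L, FreeGroup.mk L = w := Quot.exists_rep w
    rw [MonoidHom.mem_ker, MonoidHom.mem_ker, StdGen.lift_mk_eq_wordAct, StdGen.lift_mk_eq_wordAct]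
    exact ⟨Q.wordAct_eq_one P, P.wordAct_eq_one Q⟩
  obtain ⟨Φ, hΦ⟩ := StdGen.exists_mulEquiv_of_ker_eq hker
    (StdGen.range_lift_eq_gen (Equiv.refl A)) (StdGen.range_lift_eq_gen θ')
  refine ⟨Φ, fun f => Subtype.ext ?_⟩
  have := hΦ (FreeGroup.of f) (by
    rw [FreeGroup.lift_apply_of]
    exact (StdGen.toGen f).2)
  simp only [FreeGroup.lift_apply_of] at this
  exact this
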